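/- Let $(M,J)$ be the toric complex manifold of complex dimension $m$ (Hausdorff) of a smooth fan $\Sigma$ in $\mathfrak g=\mathbb R^m$ with lattice $\mathbb Z^m$ and with finitely many rays, whose primitive generators are $\lambda_1,\dots,\lambda_d\in\mathbb Z^m$. Write $\exp:\mathfrak g\to T^m\subset(\mathbb C^\times)^m$, $\exp(v)=(e^{2\pi i v_1},\dots,e^{2\pi i v_m})$, and identify $\mathfrak g^*=\mathbb R^m$ with pairing $\langle\cdot,\cdot\rangle$. Let $\omega$ be a $T^m$-invariant Kähler form on $M$ with a ($T^m$-invariant) moment map $\mu:M\to\mathfrak g^*$, $d\langle\mu,v\rangle=-\omega(v_p,\cdot)$ where $v_p=\frac{d}{dt}|_{t=0}\exp(tv)\cdot p$, let $\Delta=\mu(M)$, and assume that $\overline\Delta=\bigcap_{i=1}^d\{y\mid\langle y,\lambda_i\rangle\ge\kappa_i\}$ for some $\kappa_i\in\mathbb R$. Let $\gamma\in\mathbb Z^m$ satisfy $\langle\gamma,\lambda_i\rangle=1$ for all $i$, and let $\Omega_\gamma$ be the holomorphic $(m,0)$-form on $M$ which equals $e^{\gamma_1z^1+\dots+\gamma_mz^m}dz^1\wedge\dots\wedge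 dz^m$ in the logarithmic coordinates of the open $(\mathbb C^\times)^m$-orbit. Let $\sigma:M\to M$ be the anti-holomorphic involution that is complex conjugation on the open orbit $(\mathbb C^\times)^m$, and let $M^\sigma$ be its fixed point set. Let $\zeta_1,\dots,\zeta_n\in\mathfrak g$ be linearly independent ($0\le n\le m$), $V_\zeta=\mathrm{Span}_{\mathbb R}\{\zeta_1,\dots,\zeta_n\}$, and $c_1,\dots,c_n\in\mathbb R$. Assume that the affine plane $\{y\mid\langle y,\zeta_i\rangle=c_i\ \forall i\}$ meets the interior of $\Delta$, and that every $y\in\Delta$ on this plane is $\zeta$-regular, i.e. $V_\zeta\cap\mathrm{Span}_{\mathbb R}\{\lambda_i\mid\langle y,\lambda_i\rangle=\kappa_i\}=\{0\}$. Put $$M^\sigma_{\zeta,c}=\{p\in M^\sigma\mid\langle\mu(p),\zeta_i\rangle=c_i,\ i=1,\dots,n\}.$$ Then $M^\sigma_{\zeta,c}$ is a smooth embedded submanifold of $M$ of real dimension $m-n$. Consider $F_{\zeta,c}:L_{\zeta,c}\to M$ in each of the following two situations: (I) $L_{\zeta,c}=M^\sigma_{\zeta,c}\times U$ and $F_{\zeta,c}(p,v)=\exp(v)\cdot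 p$, where $U\subset V_\zeta$ is an open ball centred at $0$ with $U\cap\frac12\mathbb Z^m=\{0\}$; (II) $V_\zeta\cap\mathbb Z^m$ has a $\mathbb Z$-basis which is an $\mathbb R$-basis of $V_\zeta$, $L_{\zeta,c}=M^\sigma_{\zeta,c}\times V_\zeta/(V_\zeta\cap\mathbb Z^m)$ and $F_{\zeta,c}(p,[v])=\exp(v)\cdot p$. In both situations $F_{\zeta,c}$ is a Lagrangian immersion, and it is special Lagrangian if and only if $\langle\gamma,\zeta_i\rangle=0$ for every $i=1,\dots,n$. Here a Lagrangian immersion $F:L\to M$ is called special Lagrangian if its Lagrangian angle $\theta_F:L\to\mathbb R/\pi\mathbb Z$, $\theta_F=\arg h$ modulo $\pi$ where $F^*\Omega_\gamma=h\,dx^1\wedge\dots\wedge dx^m$ in local coordinates of $L$, is constant. -/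

import Mathlib

open scoped Manifold ContDiff Topology

noncomputable section

namespace ToricCY

/-! ### The torus, its Lie algebra and the integral lattice -/

/-- The Lie algebra `𝔤 ≅ ℝ^m` of the real torus `T^m`, normalised so that the kernel of the
exponential map is `ℤ^m`. The dual `𝔤^*` is identified with `ℝ^m` through `pair`. -/
abbrev Lie (m : ℕ) : Type := EuclideanSpace ℝ (Fin m)

/-- The model space `ℂ^m` of an `m`-dimensional complex manifold. -/
abbrev Cm (m : ℕ) : Type := Fin m → ℂ

/-- The complex torus `T^m_ℂ = (ℂ^×)^m`. -/
abbrev CTorus (m : ℕ) : Type := Fin m → ℂˣ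

/-- The pairing `⟨y, v⟩` of `y ∈ 𝔤^* ≅ ℝ^m` with `v ∈ 𝔤 ≅ ℝ^m`. -/
def pair {m : ℕ} (y v : Lie m) : ℝ := ∑ j, y j * v j

/-- An integral vector, seen in `ℝ^m`. -/
def intVec {m : ℕ} (a : Fin m → ℤ) : Lie m := WithLp.toLp 2 fun j => (a j : ℝ)

/-- The integral lattice `ℤ_𝔤 = ℤ^m ⊂ 𝔤`. -/
def intLattice (m : ℕ) : AddSubgroup (Lie m) where
  carrier := {v | ∃ a : Fin m → ℤ, v = intVec a}
  zero_mem' := ⟨0, by ext j; simp [intVec]⟩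
  add_mem' := by
    rintro _ _ ⟨a, rfl⟩ ⟨b, rfl⟩
    exact ⟨a + b, by ext j; simp [intVec]⟩
  neg_mem' := by
    rintro _ ⟨a, rfl⟩
    exact ⟨-a, by ext j; simp [intVec]⟩

/-- The exponential map `exp : 𝔤 → T^m ⊂ T^m_ℂ`, `v ↦ (e^{2πi v_1}, …, e^{2πi v_m})`. -/
def expT {m : ℕ} (v : Lie m) : CTorus m := fun j =>
  Units.mk0 (Complex.exp (2 * Real.pi * Complex.I * (v j : ℂ))) (Complex.exp_ne_zero _)

/-- The logarithmic parametrisation `z ↦ (e^{z_1}, …, e^{z_m})` of `T^m_ℂ`. -/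
def cexpT {m : ℕ} (z : Cm m) : CTorus m := fun j =>
  Units.mk0 (Complex.exp (z j)) (Complex.exp_ne_zero _)

/-- Complex conjugation on `T^m_ℂ`. -/
def conjT {m : ℕ} (u : CTorus m) : CTorus m := fun j =>
  Units.mk0 ((starRingEnd ℂ) (u j : ℂ)) (by simp)

/-! ### Smooth fans and toric manifolds -/

/-- The cone `{∑_{i ∈ S} a_i λ_i | a_i ≥ 0} ⊂ 𝔤`. -/
def coneOf {m d : ℕ} (ray : Fin d → (Fin m → ℤ)) (S : Finset (Fin d)) : Set (Lie m) :=
  {v | ∃ a : Fin d → ℝ, (∀ i, 0 ≤ a i) ∧ v = ∑ i ∈ S, a i • intVec (ray i)}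

/-- A smooth (i.e. regular) finite fan `Σ` in `ℝ^m` with lattice `ℤ^m`. Every cone of such a fan
is generated by the primitive generators `ray i = λ_i` of its one-dimensional faces, so a cone is
recorded by the set `S` of the indices of its rays. -/
structure SmoothFan (m d : ℕ) where
  ray : Fin d → (Fin m → ℤ)
  cones : Set (Finset (Fin d))
  empty_mem : ∅ ∈ cones
  singleton_mem : ∀ i, {i} ∈ cones
  face_mem : ∀ S ∈ cones, ∀ S' ⊆ S, S' ∈ cones
  /-- The generators of every cone are part of a `ℤ`-basis of `ℤ^m`. -/
  smooth : ∀ S ∈ cones, ∃ b : Module.Basis (Fin m) ℤ (Fin m → ℤ), ∃ e : S ↪ Fin m,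
    ∀ i : S, b (e i) = ray i
  /-- Two cones meet in a common face. -/
  inter_eq : ∀ S ∈ cones, ∀ S' ∈ cones, coneOf ray S ∩ coneOf ray S' = coneOf ray (S ∩ S')

/-- The character `χ^{b_j^*}(u) = ∏_k u_k^{b_j^*(e_k)}` of `T^m_ℂ`, where `b^*` is the basis dual to
the `ℤ`-basis `b` of `ℤ^m`. -/
def dualChar {m : ℕ} (b : Module.Basis (Fin m) ℤ (Fin m → ℤ)) (j : Fin m) (u : CTorus m) : ℂˣ :=
  ∏ k, u k ^ (b.repr (Pi.single k 1) j)

/-- The complex manifold `M` with its action of `T^m_ℂ` is the toric manifold of the fan `Σ`.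
For every cone `S` there is the affine toric chart `U_S ≅ ℂ^S × (ℂ^×)^{m - |S|}`: we complete
`(λ_i)_{i ∈ S}` to a `ℤ`-basis `b` of `ℤ^m`, and `U_S` is an invariant open set on which the
characters `χ^{b_j^*}` are holomorphic coordinates `w_j`, where `w_j` vanishes somewhere on `U_S`
if and only if `b_j` is one of the `λ_i`. The charts cover `M`, and they are glued along
the identity of the open orbit `T^m_ℂ · base ≅ T^m_ℂ`. -/
structure ToricManifold {m d : ℕ} (Sg : SmoothFan m d) (M : Type*) [TopologicalSpace M]
    [ChartedSpace (Cm m) M] [MulAction (CTorus m) M] where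
  basis : Sg.cones → Module.Basis (Fin m) ℤ (Fin m → ℤ)
  idx : (S : Sg.cones) → S.1 ↪ Fin m
  basis_idx : ∀ (S : Sg.cones) (i : S.1), basis S (idx S i) = Sg.ray i
  chart : Sg.cones → OpenPartialHomeomorph M (Cm m)
  chart_mem : ∀ S, chart S ∈ IsManifold.maximalAtlas 𝓘(ℂ, Cm m) ω M
  chart_target : ∀ S, (chart S).target = {w | ∀ j ∉ Set.range (idx S), w j ≠ 0}
  smul_mem_source : ∀ (S) (u : CTorus m) (p : M), p ∈ (chart S).source → u • p ∈ (chart S).source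
  chart_smul : ∀ (S) (u : CTorus m) (p : M), p ∈ (chart S).source → ∀ j,
    chart S (u • p) j = (dualChar (basis S) j u : ℂ) * chart S p j
  base : M
  base_mem_source : ∀ S, base ∈ (chart S).source
  chart_base : ∀ S, chart S base = 1
  cover : ∀ p : M, ∃ S, p ∈ (chart S).source

section

variable {m d : ℕ} {Sg : SmoothFan m d} {M : Type*} [TopologicalSpace M]
  [ChartedSpace (Cm m) M] [MulAction (CTorus m) M]

/-- A cone `S` with `p ∈ U_S`. -/
def ToricManifold.coneAt (X : ToricManifold Sg M) (p : M) : Sg.cones := (X.cover p).choose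

theorem ToricManifold.mem_source_coneAt (X : ToricManifold Sg M) (p : M) :
    p ∈ (X.chart (X.coneAt p)).source := (X.cover p).choose_spec

/-- The anti-holomorphic involution `σ : M → M` determined by the fan: complex conjugation of
the coordinates in every affine toric chart. -/
def ToricManifold.conj (X : ToricManifold Sg M) (p : M) : M :=
  (X.chart (X.coneAt p)).symm fun j => (starRingEnd ℂ) (X.chart (X.coneAt p) p j)

/-- The real form `M^σ`. -/
def ToricManifold.realForm (X : ToricManifold Sg M) : Set M := {p | X.conj p = p}

/-- The holomorphic `(m,0)`-form `Ω_γ` at `p`, evaluated at tangent vectors `Y_1, …, Y_m`.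
It is the extension to `M` of the form `e^{γ_1 z^1 + ⋯ + γ_m z^m} dz^1 ∧ ⋯ ∧ dz^m` in the
logarithmic coordinates `z` of the open orbit (see `volumeForm_openOrbit`): in the coordinates
`w_j = χ^{b_j^*}` of an affine toric chart, the latter form is
`det(b) ∏_j w_j^{⟨γ, b_j⟩ - 1} dw_1 ∧ ⋯ ∧ dw_m`, and the exponent of `w_j` is zero when
`b_j` is a ray, i.e. whenever `w_j` has zeros, as soon as `⟨γ, λ_i⟩ = 1` for all `i`. -/
def ToricManifold.volumeForm (X : ToricManifold Sg M) (γ : Fin m → ℤ) (p : M)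
    (Y : Fin m → TangentSpace 𝓘(ℝ, Cm m) p) : ℂ :=
  let S := X.coneAt p
  ((Matrix.of fun j k => X.basis S j k).det : ℂ)
    * (∏ j, (X.chart S p j) ^ ((∑ k, γ k * X.basis S j k) - 1))
    * (Matrix.of fun i j =>
        (mfderiv 𝓘(ℝ, Cm m) 𝓘(ℝ, Cm m) (X.chart S) p (Y i) : Cm m) j).det

/-! ### Kähler forms and moment maps -/

/-- Multiplication by `i` on the tangent spaces of the complex manifold `M`. -/
def complexStr {p : M} (Y : TangentSpace 𝓘(ℝ, Cm m) p) : TangentSpace 𝓘(ℝ, Cm m) p :=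
  let Y' : Cm m := Y
  (Complex.I • Y' : Cm m)

/-- The expression of a real 2-form in the chart `chartAt x`. -/
def localForm (w : (p : M) → TangentSpace 𝓘(ℝ, Cm m) p [⋀^Fin 2]→L[ℝ] ℝ) (x : M) (y : Cm m) :
    Cm m [⋀^Fin 2]→L[ℝ] ℝ :=
  (w ((chartAt (Cm m) x).symm y)).compContinuousLinearMap
    (mfderiv 𝓘(ℝ, Cm m) 𝓘(ℝ, Cm m) (chartAt (Cm m) x).symm y)

/-- A Kähler form on the complex manifold `M`: a smooth closed real 2-form `w` such that
`g(Y, Z) = w(Y, JZ)` is a Riemannian metric that is invariant under `J`. -/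
structure IsKahlerForm (w : (p : M) → TangentSpace 𝓘(ℝ, Cm m) p [⋀^Fin 2]→L[ℝ] ℝ) : Prop where
  smooth : ∀ x, ContDiffOn ℝ ∞ (localForm w x) (chartAt (Cm m) x).target
  closed : ∀ x, ∀ y ∈ (chartAt (Cm m) x).target, extDeriv (localForm w x) y = 0
  map_complexStr : ∀ p Y Z, w p ![complexStr Y, complexStr Z] = w p ![Y, Z]
  pos : ∀ p Y, Y ≠ 0 → 0 < w p ![Y, complexStr Y]

/-- The tangent vector `v_p = d/dt|_{t=0} exp(tv) · p`. -/
def fundVec (v : Lie m) (p : M) : TangentSpace 𝓘(ℝ, Cm m) p :=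
  (mfderiv 𝓘(ℝ, ℝ) 𝓘(ℝ, Cm m) (fun t : ℝ => expT (t • v) • p) 0 (1 : ℝ) : Cm m)

/-- A toric Kähler structure on the toric manifold of the fan `Σ`: a `T^m`-invariant Kähler form
`w` with a moment map `μ : M → 𝔤^*`, such that the closure of the moment polytope
`Δ = μ(M)` is the intersection of the half-spaces `⟨y, λ_i⟩ ≥ κ_i`.
The metric is `g(Y, Z) = w(Y, JZ)`. -/
structure ToricKahler (X : ToricManifold Sg M) where
  form : (p : M) → TangentSpace 𝓘(ℝ, Cm m) p [⋀^Fin 2]→L[ℝ] ℝ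
  isKahlerForm : IsKahlerForm form
  form_invariant : ∀ (v : Lie m) (p : M) (Y Z : TangentSpace 𝓘(ℝ, Cm m) p),
    form (expT v • p) ![mfderiv 𝓘(ℝ, Cm m) 𝓘(ℝ, Cm m) (fun q : M => expT v • q) p Y,
      mfderiv 𝓘(ℝ, Cm m) 𝓘(ℝ, Cm m) (fun q : M => expT v • q) p Z] = form p ![Y, Z]
  mu : M → Lie m
  mu_smooth : ContMDiff 𝓘(ℝ, Cm m) 𝓘(ℝ, Lie m) ∞ mu
  mu_invariant : ∀ (v : Lie m) (p : M), mu (expT v • p) = mu p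
  /-- `d⟨μ, v⟩ = -w(v_p, ·)`. -/
  mu_moment : ∀ (v : Lie m) (p : M) (Y : TangentSpace 𝓘(ℝ, Cm m) p),
    (mfderiv 𝓘(ℝ, Cm m) 𝓘(ℝ, ℝ) (fun q => pair (mu q) v) p Y : ℝ) = -form p ![fundVec v p, Y]
  kappa : Fin d → ℝ
  closure_polytope : closure (Set.range mu) = ⋂ i, {y | kappa i ≤ pair y (intVec (Sg.ray i))}

/-- The subspace `𝔷_y = Span {λ_i | ⟨y, λ_i⟩ = κ_i}` of `𝔤`. -/
def ToricKahler.stabSpan {X : ToricManifold Sg M} (K : ToricKahler X) (y : Lie m) :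
    Submodule ℝ (Lie m) :=
  Submodule.span ℝ {v | ∃ i, pair y (intVec (Sg.ray i)) = K.kappa i ∧ v = intVec (Sg.ray i)}

/-! ### The immersions `F_{ζ,c}` -/

/-- `V_ζ`, the real span of `ζ_1, …, ζ_n`. -/
def spanZeta {n : ℕ} (ζ : Fin n → Lie m) : Submodule ℝ (Lie m) := Submodule.span ℝ (Set.range ζ)

/-- `y` is a `ζ`-regular point: `V_ζ ∩ 𝔷_y = 0`. -/
def ToricKahler.IsRegularPt {X : ToricManifold Sg M} (K : ToricKahler X) {n : ℕ}
    (ζ : Fin n → Lie m) (y : Lie m) : Prop := spanZeta ζ ⊓ K.stabSpan y = ⊥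

/-- `M^σ_{ζ,c} = {p ∈ M^σ | ⟨μ(p), ζ_i⟩ = c_i for all i}`. -/
def ToricKahler.realLevel {X : ToricManifold Sg M} (K : ToricKahler X) {n : ℕ}
    (ζ : Fin n → Lie m) (c : Fin n → ℝ) : Set M :=
  {p | p ∈ X.realForm ∧ ∀ i, pair (K.mu p) (ζ i) = c i}

/-- The structure of an embedded `k`-dimensional smooth submanifold on a subset `S` of `M` (with
the subspace topology). -/
structure EmbeddedSubmanifold (m : ℕ) {M : Type*} [TopologicalSpace M] [ChartedSpace (Cm m) M]
    (S : Set M) (k : ℕ) where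
  chartedSpace : ChartedSpace (EuclideanSpace ℝ (Fin k)) S
  isManifold : IsManifold (𝓡 k) ∞ S
  smooth_val : ContMDiff (𝓡 k) 𝓘(ℝ, Cm m) ∞ (Subtype.val : S → M)
  injective_mfderiv : ∀ p : S, Function.Injective
    (mfderiv (𝓡 k) 𝓘(ℝ, Cm m) (Subtype.val : S → M) p)

/-- The ball `U` of radius `r` around `0` in `V_ζ`. -/
def ballZeta {n : ℕ} (ζ : Fin n → Lie m) (r : ℝ) : TopologicalSpace.Opens (spanZeta ζ) :=
  ⟨Metric.ball 0 r, Metric.isOpen_ball⟩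

/-- `F_{ζ,c}(p, v) = exp(v) · p` on `M^σ_{ζ,c} × U`. -/
def ToricKahler.immBall {X : ToricManifold Sg M} (K : ToricKahler X) {n : ℕ}
    (ζ : Fin n → Lie m) (c : Fin n → ℝ) (r : ℝ) : K.realLevel ζ c × ballZeta ζ r → M :=
  fun x => expT ((x.2 : spanZeta ζ) : Lie m) • (x.1 : M)

/-- The lattice `V_ζ ∩ ℤ_𝔤` in `V_ζ`. -/
def latticeZeta {n : ℕ} (ζ : Fin n → Lie m) : AddSubgroup (spanZeta ζ) :=
  (intLattice m).comap (spanZeta ζ).subtype.toAddMonoidHom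

/-- `T_ζ = V_ζ / (V_ζ ∩ ℤ_𝔤)`. -/
abbrev TorusZeta {n : ℕ} (ζ : Fin n → Lie m) : Type := spanZeta ζ ⧸ latticeZeta ζ

/-- The special condition: `V_ζ ∩ ℤ_𝔤` has a `ℤ`-basis that is a real basis of `V_ζ`. -/
def SpecialCondition {n : ℕ} (ζ : Fin n → Lie m) : Prop :=
  ∃ v : Fin n → Lie m, LinearIndependent ℝ v ∧ Submodule.span ℝ (Set.range v) = spanZeta ζ ∧
    ∀ w : Lie m, w ∈ AddSubgroup.closure (Set.range v) ↔ w ∈ spanZeta ζ ∧ w ∈ intLattice m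

end

theorem expT_add_int {m : ℕ} (v w : Lie m) (hw : w ∈ intLattice m) : expT (v + w) = expT v := by
  obtain ⟨a, rfl⟩ := hw
  funext j
  ext
  simp only [expT, Units.val_mk0]
  rw [Complex.exp_eq_exp_iff_exists_int]
  exact ⟨a j, by simp [intVec]; ring⟩

theorem one_le_norm_of_mem_latticeZeta {m n : ℕ} (ζ : Fin n → Lie m) (v : spanZeta ζ)
    (hv : v ∈ latticeZeta ζ) (h0 : v ≠ 0) : 1 ≤ ‖v‖ := by
  obtain ⟨a, ha⟩ : (v : Lie m) ∈ intLattice m := hv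
  have hne : a ≠ 0 := by
    rintro rfl
    exact h0 (Subtype.ext (by rw [ha]; ext j; simp [intVec]))
  obtain ⟨j, hj⟩ := Function.ne_iff.1 hne
  have h1 : (1 : ℝ) ≤ |(a j : ℝ)| := by exact_mod_cast Int.one_le_abs hj
  have h2 := PiLp.norm_apply_le (v : Lie m) j
  rw [ha] at h2
  have h3 : ‖(intVec a : Lie m) j‖ = |(a j : ℝ)| := by simp [intVec]
  rw [h3, ← ha] at h2
  exact h1.trans h2

theorem isDiscrete_latticeZeta {m n : ℕ} (ζ : Fin n → Lie m) :
    IsDiscrete (latticeZeta ζ : Set (spanZeta ζ)) := by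
  refine ⟨DiscreteTopology.of_forall_le_dist (r := 1) one_pos fun x y hne => ?_⟩
  change (1 : ℝ) ≤ dist (x : spanZeta ζ) (y : spanZeta ζ)
  rw [dist_eq_norm]
  exact one_le_norm_of_mem_latticeZeta ζ _ ((latticeZeta ζ).sub_mem x.2 y.2)
    (sub_ne_zero.2 fun h => hne (Subtype.ext h))

theorem isLocalHomeomorph_torusZeta {m n : ℕ} (ζ : Fin n → Lie m) :
    IsLocalHomeomorph (QuotientAddGroup.mk : spanZeta ζ → TorusZeta ζ) :=
  ((latticeZeta ζ).isAddQuotientCoveringMap_of_comm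
    (isDiscrete_latticeZeta ζ)).isCoveringMap.isLocalHomeomorph

/-- The manifold structure of the torus `T_ζ`: the charts are the local inverses of the
projection `V_ζ → T_ζ`. -/
instance chartedSpaceTorusZeta {m n : ℕ} (ζ : Fin n → Lie m) :
    ChartedSpace (spanZeta ζ) (TorusZeta ζ) :=
  (isLocalHomeomorph_torusZeta ζ).chartedSpace Quotient.mk_surjective

instance isManifoldTorusZeta {m n : ℕ} (ζ : Fin n → Lie m) :
    IsManifold 𝓘(ℝ, spanZeta ζ) ∞ (TorusZeta ζ) := by
  have key : ∀ (a b : spanZeta ζ),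
      ContDiffOn ℝ ∞ (((isLocalHomeomorph_torusZeta ζ).localInverseAt a).symm.trans
        ((isLocalHomeomorph_torusZeta ζ).localInverseAt b))
        (((isLocalHomeomorph_torusZeta ζ).localInverseAt a).symm.trans
        ((isLocalHomeomorph_torusZeta ζ).localInverseAt b)).source := by
    intro a b
    set hf := isLocalHomeomorph_torusZeta ζ
    set h := (hf.localInverseAt a).symm.trans (hf.localInverseAt b) with hh
    have hmem : ∀ y ∈ h.source, h y - y ∈ latticeZeta ζ := by
      intro y hy
      have hy' : (QuotientAddGroup.mk y : TorusZeta ζ) ∈ (hf.localInverseAt b).source := by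
        have := hy.2
        simpa using this
      have h1 := hf.apply_localInverseAt_of_mem hy'
      have h2 : h y = hf.localInverseAt b (QuotientAddGroup.mk y) := by
        simp [hh]
      rw [h2]
      have h3 := QuotientAddGroup.eq.1 h1.symm
      rwa [neg_add_eq_sub] at h3
    intro y hy
    have hc : ContinuousAt (fun x => h x - x) y :=
      (h.continuousAt hy).sub continuousAt_id
    have hev : ∀ᶠ x in 𝓝 y, h x = x + (h y - y) := by
      filter_upwards [hc (Metric.ball_mem_nhds _ one_pos), h.open_source.mem_nhds hy] with x hx hxs
      by_contra hne
      have hx' : ‖(h x - x) - (h y - y)‖ < 1 := by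
        simpa [dist_eq_norm] using hx
      refine absurd (one_le_norm_of_mem_latticeZeta ζ _
        ((latticeZeta ζ).sub_mem (hmem x hxs) (hmem y hy)) ?_) (not_le.2 hx')
      intro h0
      exact hne (by rw [← sub_eq_zero.1 h0]; abel)
    exact ((contDiffAt_id.add contDiffAt_const).congr_of_eventuallyEq hev).contDiffWithinAt
  refine isManifold_of_contDiffOn _ _ _ ?_
  rintro e e' ⟨q, rfl⟩ ⟨q', rfl⟩
  have hr : ∀ v : spanZeta ζ, chartAt (spanZeta ζ) v = OpenPartialHomeomorph.refl (spanZeta ζ) :=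
    fun _ => rfl
  simp only [hr, OpenPartialHomeomorph.trans_refl]
  simpa using key _ _

/-- `F_{ζ,c}(p, [v]) = exp(v) · p` on `M^σ_{ζ,c} × T_ζ`. -/
def ToricKahler.immTorus {m d : ℕ} {Sg : SmoothFan m d} {M : Type*} [TopologicalSpace M]
    [ChartedSpace (Cm m) M] [MulAction (CTorus m) M] {X : ToricManifold Sg M} (K : ToricKahler X)
    {n : ℕ} (ζ : Fin n → Lie m) (c : Fin n → ℝ) : K.realLevel ζ c × TorusZeta ζ → M :=
  fun x => Quotient.liftOn x.2 (fun v : spanZeta ζ => expT (v : Lie m) • (x.1 : M)) (by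
    intro v w h
    have h' : -v + w ∈ latticeZeta ζ := QuotientAddGroup.leftRel_apply.1 h
    have h2 : ((-v + w : spanZeta ζ) : Lie m) ∈ intLattice m := h'
    have h3 := expT_add_int (v : Lie m) _ h2
    have h4 : (v : Lie m) + ((-v + w : spanZeta ζ) : Lie m) = w := by simp
    rw [h4] at h3
    simp only [h3])

/-! ### Special Lagrangian immersions -/

section

variable {m : ℕ} {M : Type*} [TopologicalSpace M] [ChartedSpace (Cm m) M]
  {E : Type*} [NormedAddCommGroup E] [NormedSpace ℝ E] {H : Type*} [TopologicalSpace H]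
  (I : ModelWithCorners ℝ E H) {L : Type*} [TopologicalSpace L] [ChartedSpace H L]

/-- `F : L → M` is a Lagrangian immersion of an `m`-dimensional manifold for the 2-form `w`. -/
structure IsLagrangianImmersion
    (w : (p : M) → TangentSpace 𝓘(ℝ, Cm m) p [⋀^Fin 2]→L[ℝ] ℝ) (F : L → M) : Prop where
  finrank_eq : Module.finrank ℝ E = m
  smooth : ContMDiff I 𝓘(ℝ, Cm m) ∞ F
  injective_mfderiv : ∀ x, Function.Injective (mfderiv I 𝓘(ℝ, Cm m) F x)
  pullback_eq_zero : ∀ (x : L) (Y Z : TangentSpace I x),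
    w (F x) ![mfderiv I 𝓘(ℝ, Cm m) F x Y, mfderiv I 𝓘(ℝ, Cm m) F x Z] = 0

/-- The Lagrangian angle at `x` of the immersion `F : L → M` is `θ ∈ ℝ/πℤ`: for a frame `b` of
`T_x L` (such as the coordinate frame of a chart), the complex number
`h = (F^*Ω)(b_1, …, b_m)` is nonzero and `arg h ≡ θ` modulo `π`. Another
frame multiplies `h` by a nonzero real number, which does not change `arg h` modulo `π`. -/
def HasLagrangianAngle (Om : (p : M) → (Fin m → TangentSpace 𝓘(ℝ, Cm m) p) → ℂ)
    (F : L → M) (x : L) (θ : AddCircle Real.pi) : Prop :=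
  ∀ b : Module.Basis (Fin m) ℝ (TangentSpace I x),
    Om (F x) (fun j => mfderiv I 𝓘(ℝ, Cm m) F x (b j)) ≠ 0 ∧
    (Complex.arg (Om (F x) (fun j => mfderiv I 𝓘(ℝ, Cm m) F x (b j))) : AddCircle Real.pi) = θ

/-- `F : L → M` is special Lagrangian (with some phase `e^{iθ₀}`): it is a Lagrangian immersion
and its Lagrangian angle is a constant `θ₀`. -/
def IsSpecialLagrangian (w : (p : M) → TangentSpace 𝓘(ℝ, Cm m) p [⋀^Fin 2]→L[ℝ] ℝ)
    (Om : (p : M) → (Fin m → TangentSpace 𝓘(ℝ, Cm m) p) → ℂ) (F : L → M) : Prop :=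
  IsLagrangianImmersion I w F ∧
    ∃ θ₀ : ℝ, ∀ x, HasLagrangianAngle I Om F x (θ₀ : AddCircle Real.pi)

end

section

variable {m d : ℕ} {Sg : SmoothFan m d} {M : Type*} [TopologicalSpace M]
  [ChartedSpace (Cm m) M] [MulAction (CTorus m) M]

theorem dualChar_conjT (b : Module.Basis (Fin m) ℤ (Fin m → ℤ)) (j : Fin m) (u : CTorus m) :
    (dualChar b j (conjT u) : ℂ) = (starRingEnd ℂ) (dualChar b j u : ℂ) := by
  simp [dualChar, conjT, map_prod]

/-- On the open orbit, `σ(u · base) = ū · base`. -/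
theorem ToricManifold.conj_smul_base (X : ToricManifold Sg M) (u : CTorus m) :
    X.conj (u • X.base) = conjT u • X.base := by
  set S := X.coneAt (u • X.base) with hS
  have h1 : (fun j => (starRingEnd ℂ) (X.chart S (u • X.base) j))
      = X.chart S (conjT u • X.base) := by
    funext j
    rw [X.chart_smul S _ _ (X.base_mem_source S), X.chart_smul S _ _ (X.base_mem_source S),
      dualChar_conjT, X.chart_base]
    simp
  rw [ToricManifold.conj, ← hS, h1]
  exact (X.chart S).left_inv (X.smul_mem_source S _ _ (X.base_mem_source S))

theorem dualChar_cexpT (b : Module.Basis (Fin m) ℤ (Fin m → ℤ)) (j : Fin m) (z : Cm m) :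
    (dualChar b j (cexpT z) : ℂ) = Complex.exp (∑ k, (b.repr (Pi.single k 1) j : ℂ) * z k) := by
  simp [dualChar, cexpT, Complex.exp_sum, ← Complex.exp_int_mul]

/-- On the open orbit with its logarithmic coordinates `z`,
`Ω_γ = e^{γ_1 z^1 + ⋯ + γ_m z^m} dz^1 ∧ ⋯ ∧ dz^m`. -/
theorem ToricManifold.volumeForm_openOrbit [IsManifold 𝓘(ℂ, Cm m) ω M] (X : ToricManifold Sg M)
    (γ : Fin m → ℤ) (z : Cm m) (Z : Fin m → Cm m) :
    X.volumeForm γ (cexpT z • X.base) (fun i =>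
        mfderiv 𝓘(ℝ, Cm m) 𝓘(ℝ, Cm m) (fun z => cexpT z • X.base) z (Z i))
      = Complex.exp (∑ k, γ k * z k) * (Matrix.of Z).det := by
  set S := X.coneAt (cexpT z • X.base) with hS
  set b := X.basis S with hb
  set A : Matrix (Fin m) (Fin m) ℂ := Matrix.of fun j k => (b.repr (Pi.single k 1) j : ℂ) with hA
  set B : Matrix (Fin m) (Fin m) ℂ := Matrix.of fun j k => (b j k : ℂ) with hB
  -- the chart along the orbit
  have hφ : ∀ z' : Cm m, X.chart S (cexpT z' • X.base)
      = fun j => Complex.exp (∑ k, A j k * z' k) := by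
    intro z'
    funext j
    rw [X.chart_smul S _ _ (X.base_mem_source S), dualChar_cexpT, X.chart_base]
    simp [hA, hb]
  have hE : (fun z' : Cm m => cexpT z' • X.base)
      = (X.chart S).symm ∘ fun z' : Cm m => fun j => Complex.exp (∑ k, A j k * z' k) := by
    funext z'
    rw [Function.comp_apply, ← hφ z']
    exact ((X.chart S).left_inv (X.smul_mem_source S _ _ (X.base_mem_source S))).symm
  have hd : HasFDerivAt (𝕜 := ℝ)
      (fun z' : Cm m => fun j => Complex.exp (∑ k, A j k * z' k)) (ContinuousLinearMap.pi fun j =>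
        Complex.exp (∑ k, A j k * z k) •
          ∑ k, A j k • ContinuousLinearMap.proj (R := ℝ) (φ := fun _ : Fin m => ℂ) k) z := by
    rw [hasFDerivAt_pi]
    intro j
    refine HasFDerivAt.cexp ?_
    refine HasFDerivAt.fun_sum fun k _ => ?_
    exact (hasFDerivAt_apply k z).const_mul (A j k)
  have hmem : cexpT z • X.base ∈ (X.chart S).source := X.mem_source_coneAt _
  have hc1 : MDifferentiableAt 𝓘(ℝ, Cm m) 𝓘(ℝ, Cm m) (X.chart S) (cexpT z • X.base) := by
    have h := (contMDiffAt_of_mem_maximalAtlas (X.chart_mem S) hmem).mdifferentiableAt (by simp)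
    rw [mdifferentiableAt_iff] at h ⊢
    exact ⟨h.1, h.2.restrictScalars ℝ⟩
  have hc2 : MDifferentiableAt 𝓘(ℝ, Cm m) 𝓘(ℝ, Cm m) (fun z' : Cm m => cexpT z' • X.base) z := by
    rw [hE]
    refine MDifferentiableAt.comp z ?_ hd.differentiableAt.mdifferentiableAt
    have ht : (fun j => Complex.exp (∑ k, A j k * z k)) ∈ (X.chart S).target := by
      rw [← hφ z]
      exact (X.chart S).map_source hmem
    have h := (contMDiffOn_symm_of_mem_maximalAtlas (X.chart_mem S)).contMDiffAt
      ((X.chart S).open_target.mem_nhds ht) |>.mdifferentiableAt (by simp)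
    rw [mdifferentiableAt_iff] at h ⊢
    exact ⟨h.1, h.2.restrictScalars ℝ⟩
  have hcomp : ∀ Y : Cm m, (mfderiv 𝓘(ℝ, Cm m) 𝓘(ℝ, Cm m) (X.chart S) (cexpT z • X.base)
      (mfderiv 𝓘(ℝ, Cm m) 𝓘(ℝ, Cm m) (fun z' => cexpT z' • X.base) z Y) : Cm m)
      = fun j => Complex.exp (∑ k, A j k * z k) * ∑ k, A j k * Y k := by
    intro Y
    have h1 := mfderiv_comp_apply z hc1 hc2 Y
    rw [← h1]
    have h2 : (X.chart S) ∘ (fun z' : Cm m => cexpT z' • X.base)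
      = fun z' : Cm m => fun j => Complex.exp (∑ k, A j k * z' k) := funext hφ
    rw [h2, mfderiv_eq_fderiv, hd.fderiv]
    funext j
    change (Complex.exp (∑ k, A j k * z k) • ∑ k, A j k •
      ContinuousLinearMap.proj (R := ℝ) (φ := fun _ : Fin m => ℂ) k) Y = _
    simp
  have hAB : Matrix.transpose A * B = 1 := by
    ext k l
    have h1 := congrFun (b.sum_repr (Pi.single k (1 : ℤ))) l
    rw [Finset.sum_apply] at h1
    rw [Matrix.mul_apply, Matrix.one_apply]
    have h2 : ∑ j, (b.repr (Pi.single k 1) j : ℂ) * (b j l : ℂ)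
        = ((Pi.single k (1 : ℤ) : Fin m → ℤ) l : ℂ) := by
      rw [← h1]
      push_cast
      simp
    simp only [Matrix.transpose_apply, hA, hB, Matrix.of_apply]
    rw [h2, Pi.single_apply]
    by_cases h : k = l
    · simp [h]
    · simp [h, Ne.symm h]
  have hdet : A.det * B.det = 1 := by
    rw [← Matrix.det_transpose A, ← Matrix.det_mul, hAB, Matrix.det_one]
  set W : Fin m → ℂ := fun j => Complex.exp (∑ k, A j k * z k) with hW
  have hWne : ∀ j, W j ≠ 0 := fun j => Complex.exp_ne_zero _
  have hM : (Matrix.of fun i j => (mfderiv 𝓘(ℝ, Cm m) 𝓘(ℝ, Cm m) (X.chart S) (cexpT z • X.base)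
      (mfderiv 𝓘(ℝ, Cm m) 𝓘(ℝ, Cm m) (fun z' => cexpT z' • X.base) z (Z i)) : Cm m) j)
      = Matrix.of fun i j => W j * (Matrix.of Z * Matrix.transpose A) i j := by
    ext i j
    refine (congrFun (hcomp (Z i)) j).trans ?_
    simp [Matrix.mul_apply, hW, mul_comm]
  have hBdet : ((Matrix.of fun j k => X.basis S j k).det : ℂ) = B.det := by
    exact RingHom.map_det (Int.castRingHom ℂ) _
  have hprod : ∏ j, W j ^ ((∑ k, γ k * b j k) - 1) * W j = Complex.exp (∑ k, γ k * z k) := by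
    have h1 : ∀ j, W j ^ ((∑ k, γ k * b j k) - 1) * W j
        = Complex.exp (((∑ l, γ l * b j l : ℤ) : ℂ) * ∑ k, A j k * z k) := by
      intro j
      rw [← zpow_add_one₀ (hWne j), sub_add_cancel, Complex.exp_int_mul]
    rw [Finset.prod_congr rfl fun j _ => h1 j, ← Complex.exp_sum]
    congr 1
    have h3 : ∀ k l, ∑ j, A j k * (b j l : ℂ) = if k = l then 1 else 0 := by
      intro k l
      have := congrFun (congrFun hAB k) l
      rwa [Matrix.mul_apply, Matrix.one_apply] at this
    calc ∑ j, ((∑ l, γ l * b j l : ℤ) : ℂ) * ∑ k, A j k * z k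
        = ∑ j, ∑ l, ∑ k, (γ l : ℂ) * z k * (A j k * (b j l : ℂ)) := by
          refine Finset.sum_congr rfl fun j _ => ?_
          push_cast
          rw [Finset.sum_mul_sum]
          exact Finset.sum_congr rfl fun l _ => Finset.sum_congr rfl fun k _ => by ring
      _ = ∑ l, ∑ k, (γ l : ℂ) * z k * ∑ j, A j k * (b j l : ℂ) := by
          rw [Finset.sum_comm]
          refine Finset.sum_congr rfl fun l _ => ?_
          rw [Finset.sum_comm]
          exact Finset.sum_congr rfl fun k _ => (Finset.mul_sum _ _ _).symm
      _ = ∑ k, (γ k : ℂ) * z k := by simp [h3]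
  have hchart : ∀ j, X.chart S (cexpT z • X.base) j = W j := fun j => congrFun (hφ z) j
  rw [ToricManifold.volumeForm]
  simp only [← hS]
  rw [hM, hBdet, Matrix.det_mul_row, Matrix.det_mul, Matrix.det_transpose,
    Finset.prod_congr rfl fun j _ => by rw [hchart j], ← hprod, Finset.prod_mul_distrib]
  linear_combination (∏ j, W j ^ ((∑ k, γ k * b j k) - 1)) * (∏ j, W j) * (Matrix.of Z).det * hdet

end

end ToricCY

end

open ToricCY

/-! Everything is computed in an affine toric chart `w`. With `β_j` the real coordinates dual to the
lattice basis of the chart, `exp v` multiplies `w_j` by `e^{2πi β_j(v)}`, so `v_p` has components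
`2πi β_j(v) w_j`; and `σ` is `w ↦ w̄`. At a real point the fundamental vectors are therefore `i`
times real vectors.

Three pairings vanish. Torus orbits are isotropic because `μ` is constant on them
(`chartForm_fundCoord`). Real vectors at a real point are isotropic (`chartForm_real`): where
coordinates do not vanish, multiplication by `i` turns them into fundamental vectors, and where one
vanishes a reflection in the torus gives the result. Finally `v_p`, for `v ∈ V_ζ`, is orthogonal to
the level set because `⟨μ, v⟩` is constant on it. Together with torus invariance this gives `F^*ω =
0`.

Nondegeneracy comes from `ζ`-regularity and positivity of `ω(a, ia)`. Where `w_j` vanishes, `b_j` is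
a ray `λ_i` and `⟨μ(p), λ_i⟩ = κ_i` (`kappa_eq`), so the infinitesimal stabiliser of `p` lies in
`𝔷_{μ(p)}` (`mem_stabSpan`) and meets `V_ζ` in `0`. Hence the equations of the level set are
independent (`fderiv_levelMap_surjective`), and its tangent space is complementary to `{-i v_p | v ∈
V_ζ}` among real vectors (`levelDeriv_add_realFund_eq_zero`).

For the angle, a frame made of `m - n` real and `n` imaginary vectors has determinant in `ℝ^× i^n`,
while the phases of the action and the weights of `Ω_γ` multiply to a real multiple of `e^{2πi⟨γ,
v⟩}`. The angle is thus `nπ/2 + 2π⟨γ, v⟩` modulo `π` (`hasLagrangianAngle`), which is constant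
exactly when `γ` annihilates `V_ζ`. Only a local coordinate on the second factor enters, so the ball
and the torus are treated at once in `isLagrangianImmersion_and_iff`. -/

open scoped Manifold ContDiff Topology

noncomputable section

namespace ToricCY

/-! ### Coordinates with respect to a lattice basis -/

section LatticeBasis

variable {m : ℕ}

/-- The real linear extension of the `j`-th coordinate function of a `ℤ`-basis of `ℤ^m`. -/
def dualCoord (b : Module.Basis (Fin m) ℤ (Fin m → ℤ)) (j : Fin m) : Lie m →ₗ[ℝ] ℝ where
  toFun v := ∑ k, (b.repr (Pi.single k 1) j : ℝ) * v k
  map_add' v w := by simp [mul_add, Finset.sum_add_distrib]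
  map_smul' a v := by
    simp only [PiLp.smul_apply, smul_eq_mul, RingHom.id_apply, Finset.mul_sum]
    exact Finset.sum_congr rfl fun k _ => by ring

variable (b : Module.Basis (Fin m) ℤ (Fin m → ℤ))

theorem dualCoord_apply (j : Fin m) (v : Lie m) :
    dualCoord b j v = ∑ k, (b.repr (Pi.single k 1) j : ℝ) * v k := rfl

theorem dualCoord_intVec (j : Fin m) (a : Fin m → ℤ) :
    dualCoord b j (intVec a) = b.repr a j := by
  have h : b.repr a j = ∑ k, b.repr (Pi.single k 1) j * a k := by
    conv_lhs => rw [← Finset.univ_sum_single a]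
    rw [map_sum, Finsupp.finsetSum_apply]
    refine Finset.sum_congr rfl fun k _ => ?_
    have h1 : (Pi.single k (a k) : Fin m → ℤ) = a k • Pi.single k 1 := by
      rw [← Pi.single_smul, smul_eq_mul, mul_one]
    rw [h1, map_smul, Finsupp.smul_apply, smul_eq_mul, mul_comm]
  rw [dualCoord_apply, h]
  push_cast
  rfl

theorem dualCoord_intVec_self (j k : Fin m) :
    dualCoord b j (intVec (b k)) = if k = j then 1 else 0 := by
  rw [dualCoord_intVec, b.repr_self, Finsupp.single_apply]
  split_ifs <;> simp

theorem sum_repr_mul_basis (k l : Fin m) :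
    ∑ j, b.repr (Pi.single k 1) j * b j l = (Pi.single k (1 : ℤ) : Fin m → ℤ) l := by
  conv_rhs => rw [← b.sum_repr (Pi.single k (1 : ℤ)), Finset.sum_apply]
  rfl

theorem sum_dualCoord_smul (v : Lie m) : ∑ j, dualCoord b j v • intVec (b j) = v := by
  ext l
  simp only [WithLp.ofLp_sum, WithLp.ofLp_smul, Finset.sum_apply, Pi.smul_apply, intVec,
    smul_eq_mul, dualCoord_apply, Finset.sum_mul]
  rw [Finset.sum_comm]
  have : ∀ k, ∑ j, (b.repr (Pi.single k 1) j : ℝ) * v k * (b j l : ℝ)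
      = v k * ((Pi.single k (1 : ℤ) : Fin m → ℤ) l : ℝ) := by
    intro k
    rw [← sum_repr_mul_basis b k l]
    push_cast
    rw [Finset.mul_sum]
    exact Finset.sum_congr rfl fun j _ => by ring
  simp [this, Pi.single_apply]

theorem dualCoord_sum_smul (a : Fin m → ℝ) (j : Fin m) :
    dualCoord b j (∑ k, a k • intVec (b k)) = a j := by
  simp [map_sum, dualCoord_intVec_self]

theorem dualChar_expT (j : Fin m) (v : Lie m) :
    (dualChar b j (expT v) : ℂ) = Complex.exp (2 * Real.pi * Complex.I * (dualCoord b j v : ℂ)) := by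
  simp only [dualChar, expT, Units.coe_prod, Units.val_zpow_eq_zpow_val, Units.val_mk0,
    ← Complex.exp_int_mul, ← Complex.exp_sum, dualCoord_apply]
  congr 1
  push_cast
  rw [Finset.mul_sum]
  exact Finset.sum_congr rfl fun k _ => by ring

theorem exists_dualChar_cexpT_eq (t : Fin m → ℂ) (ht : ∀ j, t j ≠ 0) :
    ∃ z : Cm m, ∀ j, (dualChar b j (cexpT z) : ℂ) = t j := by
  -- In logarithmic coordinates the characters form the matrix of `b.repr`, whose inverse has
  -- entries `b l k`.
  refine ⟨fun k => ∑ l, Complex.log (t l) * (b l k : ℂ), fun j => ?_⟩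
  rw [dualChar_cexpT]
  have h : ∑ k, (b.repr (Pi.single k 1) j : ℂ) * ∑ l, Complex.log (t l) * (b l k : ℂ)
      = Complex.log (t j) := by
    simp only [Finset.mul_sum]
    rw [Finset.sum_comm]
    have h1 : ∀ l, ∑ k, (b.repr (Pi.single k 1) j : ℂ) * (Complex.log (t l) * (b l k : ℂ))
        = Complex.log (t l) * (if l = j then 1 else 0) := by
      intro l
      have h2 := dualCoord_intVec_self b j l
      rw [dualCoord_apply] at h2
      have h3 : ∑ k, (b.repr (Pi.single k 1) j : ℂ) * (b l k : ℂ) = if l = j then 1 else 0 := by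
        have := congrArg (fun x : ℝ => (x : ℂ)) h2
        simpa [intVec, apply_ite] using this
      rw [← h3, Finset.mul_sum]
      exact Finset.sum_congr rfl fun k _ => by ring
    simp [h1]
  rw [h, Complex.exp_log (ht j)]

theorem exists_dualChar_expT_eq (t : Fin m → ℂ) (ht : ∀ j, ‖t j‖ = 1) :
    ∃ v : Lie m, ∀ j, (dualChar b j (expT v) : ℂ) = t j := by
  refine ⟨∑ k, (Complex.arg (t k) / (2 * Real.pi)) • intVec (b k), fun j => ?_⟩
  rw [dualChar_expT, dualCoord_sum_smul]
  have h := Complex.norm_mul_exp_arg_mul_I (t j)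
  rw [ht j] at h
  conv_rhs => rw [← h]
  have hpi : (Real.pi : ℂ) ≠ 0 := by exact_mod_cast Real.pi_ne_zero
  push_cast
  rw [one_mul]
  congr 1
  field_simp

theorem expT_add (v w : Lie m) : expT (v + w) = expT v * expT w := by
  funext j
  ext
  simp [expT, mul_add, Complex.exp_add]

theorem expT_zero : expT (0 : Lie m) = 1 := by
  funext j
  ext
  simp [expT]

/-- For `a = γ` this matches the phase `⟨γ, v⟩` with the weights `⟨γ, b_j⟩` of `Ω_γ` in a chart. -/
theorem pair_intVec_eq_sum (a : Fin m → ℤ) (v : Lie m) :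
    pair (intVec a) v = ∑ j, ((∑ k, a k * b j k : ℤ) : ℝ) * dualCoord b j v := by
  conv_lhs => rw [← sum_dualCoord_smul b v]
  simp only [pair, intVec, WithLp.ofLp_sum, WithLp.ofLp_smul, Finset.sum_apply, Pi.smul_apply,
    smul_eq_mul, Finset.mul_sum]
  rw [Finset.sum_comm]
  refine Finset.sum_congr rfl fun j _ => ?_
  push_cast
  rw [Finset.sum_mul]
  exact Finset.sum_congr rfl fun k _ => by ring

theorem pair_add_right (y v w : Lie m) : pair y (v + w) = pair y v + pair y w := by
  simp [pair, mul_add, Finset.sum_add_distrib]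

theorem pair_smul_right (a : ℝ) (y v : Lie m) : pair y (a • v) = a * pair y v := by
  simp only [pair, PiLp.smul_apply, smul_eq_mul, Finset.mul_sum]
  exact Finset.sum_congr rfl fun j _ => by ring

theorem pair_sub_smul_left (a : ℝ) (y z v : Lie m) :
    pair (y - a • z) v = pair y v - a * pair z v := by
  simp only [pair, PiLp.sub_apply, PiLp.smul_apply, smul_eq_mul, Finset.mul_sum, sub_mul,
    Finset.sum_sub_distrib, mul_assoc]

/-- The pairing with a fixed `y` as a linear form. -/
def pairLin (y : Lie m) : Lie m →ₗ[ℝ] ℝ where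
  toFun v := pair y v
  map_add' := pair_add_right y
  map_smul' a v := by simp [pair_smul_right]

theorem continuous_pair_left (v : Lie m) : Continuous fun y : Lie m => pair y v := by
  unfold pair
  fun_prop

theorem pair_self_pos {v : Lie m} (hv : v ≠ 0) : 0 < pair v v := by
  have h : ∃ j, v j ≠ 0 := by
    by_contra! h
    exact hv (by ext j; simp [h j])
  obtain ⟨j, hj⟩ := h
  exact Finset.sum_pos' (fun k _ => mul_self_nonneg _) ⟨j, Finset.mem_univ _, mul_self_pos.2 hj⟩

end LatticeBasis

/-! ### Affine toric charts -/

section Charts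

variable {m : ℕ} {M : Type*} [TopologicalSpace M] [ChartedSpace (Cm m) M]

/-- Complex analytic transition maps are real smooth, in both directions; this moves the toric
charts into the real category in which forms and immersions live. -/
theorem mem_maximalAtlas_real {e : OpenPartialHomeomorph M (Cm m)}
    (he : e ∈ IsManifold.maximalAtlas 𝓘(ℂ, Cm m) ω M) :
    e ∈ IsManifold.maximalAtlas 𝓘(ℝ, Cm m) ∞ M := by
  intro e' he'
  obtain ⟨h1, h2⟩ := he e' he'
  have key : ∀ f : OpenPartialHomeomorph (Cm m) (Cm m),
      f ∈ contDiffGroupoid ω 𝓘(ℂ, Cm m) → f ∈ contDiffGroupoid ∞ 𝓘(ℝ, Cm m) := by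
    intro f hf
    rw [contDiffGroupoid, mem_groupoid_of_pregroupoid] at hf ⊢
    have h1 : ContDiffOn ℂ ω _ _ := hf.1
    have h2 : ContDiffOn ℂ ω _ _ := hf.2
    exact ⟨(h1.restrict_scalars ℝ).of_le le_top, (h2.restrict_scalars ℝ).of_le le_top⟩
  exact ⟨key _ h1, key _ h2⟩

/-- The differential of a chart `e` of `M` at `p`, with values in the model space. -/
def chartDeriv (e : OpenPartialHomeomorph M (Cm m)) (p : M) :
    TangentSpace 𝓘(ℝ, Cm m) p →L[ℝ] Cm m := mfderiv 𝓘(ℝ, Cm m) 𝓘(ℝ, Cm m) e p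

variable {e : OpenPartialHomeomorph M (Cm m)}

theorem mfderiv_chart_bijective (he : e ∈ IsManifold.maximalAtlas 𝓘(ℝ, Cm m) ∞ M) {p : M}
    (hp : p ∈ e.source) : Function.Bijective (chartDeriv e p) :=
  OpenPartialHomeomorph.MDifferentiable.mfderiv_bijective
    ⟨(contMDiffOn_of_mem_maximalAtlas he).mdifferentiableOn (by simp),
      (contMDiffOn_symm_of_mem_maximalAtlas he).mdifferentiableOn (by simp)⟩ hp

theorem mfderiv_chart_complexStr (he : e ∈ IsManifold.maximalAtlas 𝓘(ℂ, Cm m) ω M) {p : M}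
    (hp : p ∈ e.source) (Y : TangentSpace 𝓘(ℝ, Cm m) p) :
    chartDeriv e p (complexStr Y) = Complex.I • chartDeriv e p Y := by
  have h := ((contMDiffAt_of_mem_maximalAtlas he hp).mdifferentiableAt (by simp)).hasMFDerivAt
  set A : Cm m →L[ℂ] Cm m := mfderiv 𝓘(ℂ, Cm m) 𝓘(ℂ, Cm m) e p with hA
  have h2 : HasMFDerivAt 𝓘(ℝ, Cm m) 𝓘(ℝ, Cm m) e p (A.restrictScalars ℝ) :=
    ⟨h.1, HasFDerivWithinAt.restrictScalars ℝ h.2⟩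
  rw [chartDeriv, h2.mfderiv]
  exact A.map_smul Complex.I Y

/-- The action on `M` is given by formulas only in the toric charts, so regularity of maps into `M`
has to be read off from their chart expressions. -/
theorem mdifferentiableAt_of_chart_comp (he : e ∈ IsManifold.maximalAtlas 𝓘(ℝ, Cm m) ∞ M)
    {E : Type*} [NormedAddCommGroup E] [NormedSpace ℝ E] {H : Type*} [TopologicalSpace H]
    {I : ModelWithCorners ℝ E H} {N : Type*} [TopologicalSpace N] [ChartedSpace H N]
    {f : N → M} {x : N} (hx : ∀ᶠ y in 𝓝 x, f y ∈ e.source)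
    (hd : MDifferentiableAt I 𝓘(ℝ, Cm m) (fun y => e (f y)) x) :
    MDifferentiableAt I 𝓘(ℝ, Cm m) f x := by
  have h1 : f =ᶠ[𝓝 x] e.symm ∘ fun y => e (f y) := by
    filter_upwards [hx] with y hy
    exact (e.left_inv hy).symm
  refine MDifferentiableAt.congr_of_eventuallyEq ?_ h1
  refine MDifferentiableAt.comp x ?_ hd
  exact ((contMDiffOn_symm_of_mem_maximalAtlas he).contMDiffAt
    (e.open_target.mem_nhds (e.map_source hx.self_of_nhds))).mdifferentiableAt (by simp)

theorem contMDiffAt_of_chart_comp (he : e ∈ IsManifold.maximalAtlas 𝓘(ℝ, Cm m) ∞ M)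
    {E : Type*} [NormedAddCommGroup E] [NormedSpace ℝ E] {H : Type*} [TopologicalSpace H]
    {I : ModelWithCorners ℝ E H} {N : Type*} [TopologicalSpace N] [ChartedSpace H N]
    {f : N → M} {x : N} (hx : ∀ᶠ y in 𝓝 x, f y ∈ e.source)
    (hd : ContMDiffAt I 𝓘(ℝ, Cm m) ∞ (fun y => e (f y)) x) :
    ContMDiffAt I 𝓘(ℝ, Cm m) ∞ f x := by
  have h1 : f =ᶠ[𝓝 x] e.symm ∘ fun y => e (f y) := by
    filter_upwards [hx] with y hy
    exact (e.left_inv hy).symm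
  refine ContMDiffAt.congr_of_eventuallyEq ?_ h1
  refine ContMDiffAt.comp x ?_ hd
  exact (contMDiffOn_symm_of_mem_maximalAtlas he).contMDiffAt
    (e.open_target.mem_nhds (e.map_source hx.self_of_nhds))

theorem mfderiv_chart_comp (he : e ∈ IsManifold.maximalAtlas 𝓘(ℝ, Cm m) ∞ M)
    {E : Type*} [NormedAddCommGroup E] [NormedSpace ℝ E] {H : Type*} [TopologicalSpace H]
    {I : ModelWithCorners ℝ E H} {N : Type*} [TopologicalSpace N] [ChartedSpace H N]
    {f : N → M} {x : N} (hx : f x ∈ e.source)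
    (hd : MDifferentiableAt I 𝓘(ℝ, Cm m) f x) (Y : TangentSpace I x) :
    chartDeriv e (f x) (mfderiv I 𝓘(ℝ, Cm m) f x Y)
      = mfderiv I 𝓘(ℝ, Cm m) (fun y => e (f y)) x Y :=
  (mfderiv_comp_apply x
    ((contMDiffAt_of_mem_maximalAtlas he hx).mdifferentiableAt (by simp)) hd Y).symm

end Charts

/-! ### The torus action in affine toric charts -/

section ToricCharts

variable {m d : ℕ} {Sg : SmoothFan m d} {M : Type*} [TopologicalSpace M]
  [ChartedSpace (Cm m) M] [MulAction (CTorus m) M] (X : ToricManifold Sg M)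

theorem ToricManifold.chart_mem_real (S : Sg.cones) :
    X.chart S ∈ IsManifold.maximalAtlas 𝓘(ℝ, Cm m) ∞ M := mem_maximalAtlas_real (X.chart_mem S)

theorem ToricManifold.chart_expT_smul (S : Sg.cones) {p : M} (hp : p ∈ (X.chart S).source)
    (v : Lie m) (j : Fin m) : X.chart S (expT v • p) j
      = Complex.exp (2 * Real.pi * Complex.I * (dualCoord (X.basis S) j v : ℂ)) * X.chart S p j := by
  rw [X.chart_smul S _ _ hp, dualChar_expT]

/-- The differential of `v ↦ exp(2πi l(v)) a`. -/
theorem hasFDerivAt_exp_mul {E : Type*} [NormedAddCommGroup E] [NormedSpace ℝ E]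
    (l : E →L[ℝ] ℝ) (a : ℂ) (x : E) :
    HasFDerivAt (fun v : E => Complex.exp (2 * Real.pi * Complex.I * (l v : ℂ)) * a)
      ((Complex.exp (2 * Real.pi * Complex.I * (l x : ℂ)) * (2 * Real.pi * Complex.I) * a) •
        (Complex.ofRealCLM.comp l)) x := by
  have h1 : HasFDerivAt (fun v : E => (l v : ℂ)) (Complex.ofRealCLM.comp l) x :=
    (Complex.ofRealCLM.comp l).hasFDerivAt
  have h2 := ((h1.const_mul (2 * Real.pi * Complex.I)).cexp).mul_const a
  refine h2.congr_fderiv ?_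
  ext y
  simp
  ring

/-- The fundamental vector fields in the affine toric charts. -/
theorem ToricManifold.mfderiv_chart_fundVec (S : Sg.cones) {p : M}
    (hp : p ∈ (X.chart S).source) (v : Lie m) (j : Fin m) :
    chartDeriv (X.chart S) p (fundVec v p) j
      = 2 * Real.pi * Complex.I * (dualCoord (X.basis S) j v : ℂ) * X.chart S p j := by
  have hf : ∀ t : ℝ, expT (t • v) • p ∈ (X.chart S).source := fun t => X.smul_mem_source S _ _ hp
  have h0 : expT ((0 : ℝ) • v) • p = p := by rw [zero_smul, expT_zero, one_smul]
  have hE : HasFDerivAt (fun t : ℝ => X.chart S (expT (t • v) • p))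
      (ContinuousLinearMap.pi fun j => (2 * Real.pi * Complex.I * X.chart S p j) •
        (Complex.ofRealCLM.comp (dualCoord (X.basis S) j v • ContinuousLinearMap.id ℝ ℝ))) 0 := by
    rw [hasFDerivAt_pi']
    intro j
    have h := hasFDerivAt_exp_mul (dualCoord (X.basis S) j v • ContinuousLinearMap.id ℝ ℝ)
      (X.chart S p j) 0
    have h1 : (fun t : ℝ => X.chart S (expT (t • v) • p) j) = fun t : ℝ => Complex.exp (2 * Real.pi *
        Complex.I * (((dualCoord (X.basis S) j v • ContinuousLinearMap.id ℝ ℝ : ℝ →L[ℝ] ℝ) t : ℝ) : ℂ))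
          * X.chart S p j := by
      funext t
      rw [X.chart_expT_smul S hp]
      simp [mul_comm]
    rw [h1]
    refine h.congr_fderiv ?_
    ext
    simp
  have hd := mdifferentiableAt_of_chart_comp (X.chart_mem_real S)
    (f := fun t : ℝ => expT (t • v) • p) (x := 0) (Filter.Eventually.of_forall hf)
    hE.differentiableAt.mdifferentiableAt
  have h := mfderiv_chart_comp (X.chart_mem_real S) (f := fun t : ℝ => expT (t • v) • p) (hf 0) hd (1 : ℝ)
  rw [mfderiv_eq_fderiv, hE.fderiv] at h
  have h' := congrFun h j
  -- The curve starts at `exp(0) · p`, equal to `p` but not definitionally, so the two chart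
  -- differentials are compared as maps on the model space.
  have h2 : chartDeriv (X.chart S) p (fundVec v p) j
      = chartDeriv (X.chart S) (expT ((0 : ℝ) • v) • p)
        (mfderiv 𝓘(ℝ, ℝ) 𝓘(ℝ, Cm m) (fun t : ℝ => expT (t • v) • p) 0 (1 : ℝ)) j := by
    have key : ∀ q, q = p → (chartDeriv (X.chart S) p : Cm m →L[ℝ] Cm m)
        = chartDeriv (X.chart S) q := by rintro q rfl; rfl
    exact congrFun (congrArg (fun A : Cm m →L[ℝ] Cm m => A (fundVec v p)) (key _ h0)) j
  refine h2.trans (h'.trans ?_)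
  change (2 * Real.pi * Complex.I * X.chart S p j) *
    (((dualCoord (X.basis S) j v * 1 : ℝ)) : ℂ) = _
  simp
  ring

/-- The differential of the action of `exp v` in the affine toric charts. -/

theorem ToricManifold.mdifferentiableAt_expT_smul (X : ToricManifold Sg M) (v : Lie m) (p : M) :
    MDifferentiableAt 𝓘(ℝ, Cm m) 𝓘(ℝ, Cm m) (fun q : M => expT v • q) p := by
  set S := X.coneAt p
  have hp := X.mem_source_coneAt p
  refine mdifferentiableAt_of_chart_comp (X.chart_mem_real S) ?_ ?_
  · filter_upwards [(X.chart S).open_source.mem_nhds hp] with q hq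
    exact X.smul_mem_source S _ _ hq
  · have h : (fun q => X.chart S (expT v • q)) =ᶠ[𝓝 p] (fun w : Cm m => fun j => Complex.exp
        (2 * Real.pi * Complex.I * (dualCoord (X.basis S) j v : ℂ)) * w j) ∘ X.chart S := by
      filter_upwards [(X.chart S).open_source.mem_nhds hp] with q hq
      funext j
      exact X.chart_expT_smul S hq v j
    refine MDifferentiableAt.congr_of_eventuallyEq ?_ h
    refine MDifferentiableAt.comp p ?_
      ((contMDiffAt_of_mem_maximalAtlas (X.chart_mem_real S) hp).mdifferentiableAt (by simp))
    apply DifferentiableAt.mdifferentiableAt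
    fun_prop

/-- The differential of the action of `exp v` in the affine toric charts. -/
theorem ToricManifold.mfderiv_chart_expT_smul (S : Sg.cones) {p : M}
    (hp : p ∈ (X.chart S).source) (v : Lie m) (Y : TangentSpace 𝓘(ℝ, Cm m) p) (j : Fin m) :
    chartDeriv (X.chart S) (expT v • p)
      (mfderiv 𝓘(ℝ, Cm m) 𝓘(ℝ, Cm m) (fun q : M => expT v • q) p Y) j
      = Complex.exp (2 * Real.pi * Complex.I * (dualCoord (X.basis S) j v : ℂ))
        * chartDeriv (X.chart S) p Y j := by
  have h1 := mfderiv_chart_comp (X.chart_mem_real S) (f := fun q : M => expT v • q)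
    (X.smul_mem_source S (expT v) p hp) (X.mdifferentiableAt_expT_smul v p) Y
  refine (congrFun h1 j).trans ?_
  set a : Fin m → ℂ := fun j => Complex.exp
        (2 * Real.pi * Complex.I * (dualCoord (X.basis S) j v : ℂ)) with ha
  set A : Cm m →L[ℝ] Cm m := ContinuousLinearMap.pi fun j =>
    a j • ContinuousLinearMap.proj (R := ℝ) (φ := fun _ : Fin m => ℂ) j with hA
  have h : (fun q => X.chart S (expT v • q)) =ᶠ[𝓝 p] A ∘ X.chart S := by
    filter_upwards [(X.chart S).open_source.mem_nhds hp] with q hq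
    funext j
    exact X.chart_expT_smul S hq v j
  have hc : MDifferentiableAt 𝓘(ℝ, Cm m) 𝓘(ℝ, Cm m) (X.chart S) p :=
    (contMDiffAt_of_mem_maximalAtlas (X.chart_mem_real S) hp).mdifferentiableAt (by simp)
  rw [h.mfderiv_eq]
  have h3 := mfderiv_comp_apply p (I'' := 𝓘(ℝ, Cm m)) A.differentiableAt.mdifferentiableAt hc Y
  refine (congrFun h3 j).trans ?_
  rw [mfderiv_eq_fderiv, A.fderiv]
  rfl

end ToricCharts

/-! ### The Kähler form in the affine toric charts -/

section TwoForm

variable {V : Type*} [AddCommGroup V] [Module ℝ V] [TopologicalSpace V]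

theorem twoForm_swap (w : V [⋀^Fin 2]→L[ℝ] ℝ) (Y Z : V) : w ![Y, Z] = -w ![Z, Y] := by
  have h := w.toAlternatingMap.map_swap ![Z, Y] (i := 0) (j := 1) (by decide)
  have h2 : (![Z, Y] ∘ Equiv.swap (0 : Fin 2) 1) = ![Y, Z] := by
    funext i
    fin_cases i <;> simp
  rw [h2] at h
  exact h

/-- A 2-form as a bilinear form. -/
def twoFormBil (w : V [⋀^Fin 2]→L[ℝ] ℝ) : V →ₗ[ℝ] V →ₗ[ℝ] ℝ :=
  LinearMap.mk₂ ℝ (fun Y Z => w ![Y, Z])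
    (fun Y Y' Z => w.toAlternatingMap.map_vecCons_add ![Z] Y Y')
    (fun c Y Z => w.toAlternatingMap.map_vecCons_smul ![Z] c Y)
    (fun Y Z Z' => by
      rw [twoForm_swap w Y, twoForm_swap w Y Z, twoForm_swap w Y Z', ← neg_add]
      exact congrArg Neg.neg (w.toAlternatingMap.map_vecCons_add ![Y] Z Z'))
    (fun c Y Z => by
      rw [twoForm_swap w Y, twoForm_swap w Y Z, smul_neg]
      exact congrArg Neg.neg (w.toAlternatingMap.map_vecCons_smul ![Y] c Z))

theorem twoFormBil_apply (w : V [⋀^Fin 2]→L[ℝ] ℝ) (Y Z : V) : twoFormBil w Y Z = w ![Y, Z] := rfl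

end TwoForm

section ChartForm

variable {m d : ℕ} {Sg : SmoothFan m d} {M : Type*} [TopologicalSpace M]
  [ChartedSpace (Cm m) M] [MulAction (CTorus m) M] {X : ToricManifold Sg M}

/-- The differential of an affine toric chart as a linear equivalence. -/
def ToricManifold.chartEquiv (X : ToricManifold Sg M) (S : Sg.cones) (p : M)
    (hp : p ∈ (X.chart S).source) : TangentSpace 𝓘(ℝ, Cm m) p ≃ₗ[ℝ] Cm m :=
  LinearEquiv.ofBijective (chartDeriv (X.chart S) p).toLinearMap
    (mfderiv_chart_bijective (X.chart_mem_real S) hp)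

theorem ToricManifold.chartEquiv_apply (S : Sg.cones) {p : M}
    (hp : p ∈ (X.chart S).source) (Y : TangentSpace 𝓘(ℝ, Cm m) p) :
    X.chartEquiv S p hp Y = chartDeriv (X.chart S) p Y := rfl

/-- The Kähler form at `p` in an affine toric chart. -/
def ToricKahler.chartForm (K : ToricKahler X) (S : Sg.cones) (p : M)
    (hp : p ∈ (X.chart S).source) : Cm m →ₗ[ℝ] Cm m →ₗ[ℝ] ℝ :=
  (twoFormBil (K.form p)).compl₁₂ (X.chartEquiv S p hp).symm.toLinearMap
    (X.chartEquiv S p hp).symm.toLinearMap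

variable (K : ToricKahler X) (S : Sg.cones) {p : M} (hp : p ∈ (X.chart S).source)

theorem ToricKahler.chartForm_chartDeriv (Y Z : TangentSpace 𝓘(ℝ, Cm m) p) :
    K.chartForm S p hp (chartDeriv (X.chart S) p Y) (chartDeriv (X.chart S) p Z)
      = K.form p ![Y, Z] := by
  rw [← X.chartEquiv_apply S hp, ← X.chartEquiv_apply S hp]
  simp [chartForm, twoFormBil_apply]

theorem ToricKahler.chartForm_swap (a b : Cm m) :
    K.chartForm S p hp a b = -K.chartForm S p hp b a := twoForm_swap _ _ _

theorem ToricKahler.chartForm_self (a : Cm m) : K.chartForm S p hp a a = 0 := by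
  have := K.chartForm_swap S hp a a
  linarith

theorem ToricKahler.chartForm_I_smul (a b : Cm m) :
    K.chartForm S p hp (Complex.I • a) (Complex.I • b) = K.chartForm S p hp a b := by
  obtain ⟨Y, rfl⟩ := (mfderiv_chart_bijective (X.chart_mem_real S) hp).2 a
  obtain ⟨Z, rfl⟩ := (mfderiv_chart_bijective (X.chart_mem_real S) hp).2 b
  rw [← mfderiv_chart_complexStr (X.chart_mem S) hp, ← mfderiv_chart_complexStr (X.chart_mem S) hp,
    K.chartForm_chartDeriv, K.chartForm_chartDeriv, K.isKahlerForm.map_complexStr]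

theorem ToricKahler.chartForm_pos {a : Cm m} (ha : a ≠ 0) :
    0 < K.chartForm S p hp a (Complex.I • a) := by
  obtain ⟨Y, rfl⟩ := (mfderiv_chart_bijective (X.chart_mem_real S) hp).2 a
  rw [← mfderiv_chart_complexStr (X.chart_mem S) hp, K.chartForm_chartDeriv]
  refine K.isKahlerForm.pos p Y ?_
  rintro rfl
  exact ha (map_zero _)

theorem ToricKahler.chartForm_nonneg (a : Cm m) :
    0 ≤ K.chartForm S p hp a (Complex.I • a) := by
  by_cases ha : a = 0
  · simp [ha]
  · exact (K.chartForm_pos S hp ha).le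

/-- The fundamental vector of `v` at a point with coordinates `w` of an affine toric chart. -/
def ToricManifold.fundCoord (X : ToricManifold Sg M) (S : Sg.cones) (v : Lie m) (w : Cm m) : Cm m :=
  fun j => 2 * Real.pi * Complex.I * (dualCoord (X.basis S) j v : ℂ) * w j

theorem ToricManifold.chartDeriv_fundVec (X : ToricManifold Sg M) (S : Sg.cones) {p : M}
    (hp : p ∈ (X.chart S).source) (v : Lie m) :
    chartDeriv (X.chart S) p (fundVec v p) = X.fundCoord S v (X.chart S p) :=
  funext (X.mfderiv_chart_fundVec S hp v)

/-- The moment map in the affine toric charts. -/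
theorem ToricKahler.hasFDerivAt_mu_chart (v : Lie m) :
    HasFDerivAt (fun w => pair (K.mu ((X.chart S).symm w)) v)
      (-(K.chartForm S p hp (X.fundCoord S v (X.chart S p))).toContinuousLinearMap)
      (X.chart S p) := by
  have h1 : MDifferentiableAt 𝓘(ℝ, Cm m) 𝓘(ℝ, ℝ) (fun q => pair (K.mu q) v) p := by
    have h2 : Differentiable ℝ fun y : Lie m => pair y v := by unfold pair; fun_prop
    exact (h2 (K.mu p)).mdifferentiableAt.comp p
      (K.mu_smooth.contMDiffAt.mdifferentiableAt (by simp))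
  have hw := (X.chart S).map_source hp
  have h3 : MDifferentiableAt 𝓘(ℝ, Cm m) 𝓘(ℝ, Cm m) (X.chart S).symm (X.chart S p) :=
    ((contMDiffOn_symm_of_mem_maximalAtlas (X.chart_mem_real S)).contMDiffAt
    ((X.chart S).open_target.mem_nhds hw)).mdifferentiableAt (by simp)
  have hl := (X.chart S).left_inv hp
  have h4 : MDifferentiableAt 𝓘(ℝ, Cm m) 𝓘(ℝ, ℝ)
      (fun w => pair (K.mu ((X.chart S).symm w)) v) (X.chart S p) := by
    refine MDifferentiableAt.comp (X.chart S p) (g := fun q => pair (K.mu q) v) ?_ h3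
    rw [hl]
    exact h1
  have h5 := (mdifferentiableAt_iff_differentiableAt.1 h4).hasFDerivAt
  refine h5.congr_fderiv ?_
  ext1 a
  obtain ⟨Y, rfl⟩ := (mfderiv_chart_bijective (X.chart_mem_real S) hp).2 a
  have h6 : (fun q => pair (K.mu q) v) =ᶠ[𝓝 p]
      (fun w => pair (K.mu ((X.chart S).symm w)) v) ∘ X.chart S := by
    filter_upwards [(X.chart S).open_source.mem_nhds hp] with q hq
    rw [Function.comp_apply, (X.chart S).left_inv hq]
  have h7 := K.mu_moment v p Y
  rw [h6.mfderiv_eq] at h7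
  have h8 := mfderiv_comp_apply p h4 ((contMDiffAt_of_mem_maximalAtlas
    (X.chart_mem_real S) hp).mdifferentiableAt (by simp)) Y
  rw [mfderiv_eq_fderiv] at h8
  have h9 := h8.symm.trans h7
  rw [← K.chartForm_chartDeriv S hp, X.chartDeriv_fundVec S hp] at h9
  exact h9

/-- The orbits of the torus are isotropic. -/
theorem ToricKahler.chartForm_fundCoord (v u : Lie m) :
    K.chartForm S p hp (X.fundCoord S v (X.chart S p)) (X.fundCoord S u (X.chart S p)) = 0 := by
  set w0 := X.chart S p with hw0
  set l : Fin m → ℝ →L[ℝ] ℝ := fun j => dualCoord (X.basis S) j u • ContinuousLinearMap.id ℝ ℝ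
  have hE : HasFDerivAt
      (fun t : ℝ => fun j => Complex.exp (2 * Real.pi * Complex.I * (l j t : ℂ)) * w0 j)
      (ContinuousLinearMap.pi fun j =>
        (Complex.exp (2 * Real.pi * Complex.I * (l j 0 : ℂ)) * (2 * Real.pi * Complex.I) * w0 j) •
        (Complex.ofRealCLM.comp (l j))) 0 :=
    hasFDerivAt_pi.2 fun j => hasFDerivAt_exp_mul (l j) (w0 j) 0
  have h0 : (fun j => Complex.exp (2 * Real.pi * Complex.I * (l j 0 : ℂ)) * w0 j) = w0 := by
    funext j
    simp
  have hmu := K.hasFDerivAt_mu_chart S hp v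
  rw [← hw0] at hmu
  have hmu' := hmu
  rw [← h0] at hmu'
  have hc := hmu'.comp (0 : ℝ) hE
  -- `⟨μ, v⟩` is constant along `t ↦ exp(tu) · p` by invariance; its derivative at `0` is `-ω(v_p,
  -- u_p)`.
  have hconst : ((fun w => pair (K.mu ((X.chart S).symm w)) v) ∘
      (fun t : ℝ => fun j => Complex.exp (2 * Real.pi * Complex.I * (l j t : ℂ)) * w0 j))
      = fun _ => pair (K.mu p) v := by
    funext t
    have h1 : (fun j => Complex.exp (2 * Real.pi * Complex.I * (l j t : ℂ)) * w0 j)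
        = X.chart S (expT (t • u) • p) := by
      funext j
      rw [X.chart_expT_smul S hp]
      simp [l, mul_comm, hw0]
    rw [Function.comp_apply, h1, (X.chart S).left_inv (X.smul_mem_source S _ _ hp), K.mu_invariant]
  rw [hconst] at hc
  have h2 := congrArg (fun A : ℝ →L[ℝ] ℝ => A 1) (hc.unique (hasFDerivAt_const _ _))
  have h3 : (ContinuousLinearMap.pi fun j =>
        (Complex.exp (2 * Real.pi * Complex.I * (l j 0 : ℂ)) * (2 * Real.pi * Complex.I) * w0 j) •
        (Complex.ofRealCLM.comp (l j))) (1 : ℝ) = X.fundCoord S u w0 := by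
    funext j
    change (Complex.exp (2 * Real.pi * Complex.I * (l j 0 : ℂ)) * (2 * Real.pi * Complex.I) * w0 j) *
      ((dualCoord (X.basis S) j u * 1 : ℝ) : ℂ) = _
    simp [ToricManifold.fundCoord]
    ring
  have h4 : -(K.chartForm S p hp (X.fundCoord S v w0)) ((ContinuousLinearMap.pi fun j =>
        (Complex.exp (2 * Real.pi * Complex.I * (l j 0 : ℂ)) * (2 * Real.pi * Complex.I) * w0 j) •
        (Complex.ofRealCLM.comp (l j))) (1 : ℝ)) = 0 := by
    simpa [h0] using h2
  rw [h3] at h4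
  linarith

/-- Invariance of the Kähler form in the affine toric charts. -/
theorem ToricKahler.chartForm_expT {q : M} (hq : q ∈ (X.chart S).source) (v : Lie m)
    (h : q = expT v • p) (a b : Cm m) :
    K.chartForm S q hq
      (fun j => Complex.exp (2 * Real.pi * Complex.I * (dualCoord (X.basis S) j v : ℂ)) * a j)
      (fun j => Complex.exp (2 * Real.pi * Complex.I * (dualCoord (X.basis S) j v : ℂ)) * b j)
      = K.chartForm S p hp a b := by
  subst h
  obtain ⟨Y, rfl⟩ := (mfderiv_chart_bijective (X.chart_mem_real S) hp).2 a
  obtain ⟨Z, rfl⟩ := (mfderiv_chart_bijective (X.chart_mem_real S) hp).2 b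
  rw [K.chartForm_chartDeriv, ← K.form_invariant v p Y Z, ← K.chartForm_chartDeriv S hq]
  congr 1
  · congr 1
    funext j
    exact (X.mfderiv_chart_expT_smul S hp v Y j).symm
  · funext j
    exact (X.mfderiv_chart_expT_smul S hp v Z j).symm

/-- The torus element `exp(b_j / 2)` is the reflection `w_j ↦ -w_j`. It fixes `p` as `w_j = 0`,
reverses `∂_j` and preserves `∂_l` for `l ≠ j`, so by invariance the value equals its own negative.
-/
theorem ToricKahler.chartForm_single_of_eq_zero {j l : Fin m} (h : X.chart S p j = 0) :
    K.chartForm S p hp (Pi.single j 1) (Pi.single l 1) = 0 := by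
  by_cases hjl : j = l
  · rw [hjl, K.chartForm_self]
  set v : Lie m := (1 / 2 : ℝ) • intVec (X.basis S j) with hv
  have hβ : ∀ k, Complex.exp (2 * Real.pi * Complex.I * (dualCoord (X.basis S) k v : ℂ))
      = if k = j then -1 else 1 := by
    intro k
    rw [hv, map_smul, dualCoord_intVec_self]
    by_cases hk : j = k
    · have h1 : 2 * (Real.pi : ℂ) * Complex.I * 2⁻¹ = Real.pi * Complex.I := by ring
      simp [hk, h1, Complex.exp_pi_mul_I]
    · simp [hk, Ne.symm hk]
  have hfix : p = expT v • p := by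
    refine (X.chart S).injOn hp (X.smul_mem_source S _ _ hp) ?_
    funext k
    rw [X.chart_expT_smul S hp, hβ]
    by_cases hk : k = j
    · rw [hk, h, mul_zero]
    · simp [hk]
  have h1 := K.chartForm_expT S hp hp v hfix (Pi.single j 1) (Pi.single l 1)
  simp only [hβ] at h1
  have h2 : (fun k => (if k = j then -1 else 1) * (Pi.single j 1 : Cm m) k)
      = -(Pi.single j 1 : Cm m) := by
    funext k
    by_cases hk : k = j
    · simp [hk]
    · simp [hk]
  have h3 : (fun k => (if k = j then -1 else 1) * (Pi.single l 1 : Cm m) k)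
      = (Pi.single l 1 : Cm m) := by
    funext k
    by_cases hk : k = j
    · simp [hk, hjl]
    · simp [hk]
  rw [h2, h3, map_neg, LinearMap.neg_apply] at h1
  linarith

/-- The real form is isotropic. -/
theorem ToricKahler.chartForm_real (hreal : ∀ j, (X.chart S p j).im = 0) {a b : Cm m}
    (ha : ∀ j, (a j).im = 0) (hb : ∀ j, (b j).im = 0) : K.chartForm S p hp a b = 0 := by
  have hs : ∀ j l, K.chartForm S p hp (Pi.single j 1) (Pi.single l 1) = 0 := by
    intro j l
    by_cases hj : X.chart S p j = 0
    · exact K.chartForm_single_of_eq_zero S hp hj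
    by_cases hl : X.chart S p l = 0
    · rw [K.chartForm_swap, K.chartForm_single_of_eq_zero S hp hl, neg_zero]
    -- At a real point with `w_k ≠ 0`, the vector `i ∂_k` is the fundamental vector of `b_k / (2π
    -- w_k)`; applying `J` to both arguments then reduces to the isotropy of orbits.
    have hI : ∀ k, X.chart S p k ≠ 0 → Complex.I • (Pi.single k 1 : Cm m)
        = X.fundCoord S ((1 / (2 * Real.pi * (X.chart S p k).re)) • intVec (X.basis S k))
          (X.chart S p) := by
      intro k hk
      have h1 : ((X.chart S p k).re : ℂ) = X.chart S p k :=
        Complex.ext (by simp) (by simp [hreal k])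
      have hpi : (Real.pi : ℂ) ≠ 0 := by exact_mod_cast Real.pi_ne_zero
      funext i
      simp only [ToricManifold.fundCoord, map_smul, dualCoord_intVec_self, smul_eq_mul,
        Pi.smul_apply]
      by_cases hi : k = i
      · subst hi
        push_cast
        rw [h1]
        simp
        field_simp
      · simp [hi, Ne.symm hi]
    rw [← K.chartForm_I_smul, hI j hj, hI l hl, K.chartForm_fundCoord]
  have hexp : ∀ c : Cm m, (∀ j, (c j).im = 0) → c = ∑ j, (c j).re • (Pi.single j 1 : Cm m) := by
    intro c hc
    funext k
    rw [Finset.sum_apply, Finset.sum_eq_single k]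
    · exact Complex.ext (by simp) (by simp [hc k])
    · intro i _ hi
      simp [Ne.symm hi]
    · simp
  rw [hexp a ha, hexp b hb]
  simp [map_sum, LinearMap.sum_apply, hs]

end ChartForm

/-! ### The open orbit and the moment polytope -/

section OpenOrbit

variable {m d : ℕ} {Sg : SmoothFan m d} {M : Type*} [TopologicalSpace M]
  [ChartedSpace (Cm m) M] [MulAction (CTorus m) M] (X : ToricManifold Sg M)

theorem ToricManifold.exists_eq_smul_base (S : Sg.cones) {p : M} (hp : p ∈ (X.chart S).source)
    (h : ∀ j, X.chart S p j ≠ 0) : ∃ z : Cm m, p = cexpT z • X.base := by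
  obtain ⟨z, hz⟩ := exists_dualChar_cexpT_eq (X.basis S) _ h
  refine ⟨z, (X.chart S).injOn hp (X.smul_mem_source S _ _ (X.base_mem_source S)) ?_⟩
  funext j
  rw [X.chart_smul S _ _ (X.base_mem_source S), hz, X.chart_base, Pi.one_apply, mul_one]

/-- Replacing the vanishing coordinates by a small real `t ≠ 0` stays in the chart and lands in the
orbit, where all coordinates are nonzero; let `t → 0`. -/
theorem ToricManifold.mem_closure_orbit (p : M) :
    p ∈ closure (Set.range fun z : Cm m => cexpT z • X.base) := by
  obtain ⟨S, hp⟩ := X.cover p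
  set w := X.chart S p with hw
  set c : ℝ → Cm m := fun t j => if w j = 0 then (t : ℂ) else w j with hc
  have hcont : Continuous c := by
    refine continuous_pi fun j => ?_
    by_cases h : w j = 0
    · simpa [hc, h] using Complex.continuous_ofReal
    · simpa [hc, h] using continuous_const
  have hc0 : c 0 = w := by
    funext j
    by_cases h : w j = 0 <;> simp [hc, h]
  have hwt : w ∈ (X.chart S).target := (X.chart S).map_source hp
  have hne : ∀ t : ℝ, t ≠ 0 → ∀ j, c t j ≠ 0 := by
    intro t ht j
    by_cases h : w j = 0 <;> simp [hc, h, ht]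
  have htend : Filter.Tendsto (fun t => (X.chart S).symm (c t)) (𝓝[≠] 0) (𝓝 p) := by
    have h1 : ContinuousAt (X.chart S).symm (c 0) := by
      rw [hc0]
      exact (X.chart S).continuousAt_symm hwt
    have h2 : ContinuousAt (fun t => (X.chart S).symm (c t)) 0 :=
      ContinuousAt.comp (f := c) h1 hcont.continuousAt
    have h3 : (X.chart S).symm (c 0) = p := by rw [hc0, hw, (X.chart S).left_inv hp]
    rw [ContinuousAt, h3] at h2
    exact h2.mono_left nhdsWithin_le_nhds
  refine mem_closure_of_tendsto htend ?_
  filter_upwards [self_mem_nhdsWithin] with t ht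
  have hct : c t ∈ (X.chart S).target := by
    rw [X.chart_target]
    exact fun j _ => hne t ht j
  obtain ⟨z, hz⟩ := X.exists_eq_smul_base S ((X.chart S).map_target hct) (by
    rw [(X.chart S).right_inv hct]
    exact hne t ht)
  exact ⟨z, hz.symm⟩

/-- Every point can be moved by the real torus to a point with nonnegative coordinates. -/
theorem ToricManifold.exists_expT_smul_norm (S : Sg.cones) {p : M}
    (hp : p ∈ (X.chart S).source) :
    ∃ v : Lie m, ∀ j, X.chart S (expT v • p) j = (‖X.chart S p j‖ : ℂ) := by
  set w := X.chart S p with hw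
  obtain ⟨v, hv⟩ := exists_dualChar_expT_eq (X.basis S)
    (fun j => if w j = 0 then 1 else (‖w j‖ : ℂ) / w j) (by
      intro j
      by_cases h : w j = 0 <;> simp [h])
  refine ⟨v, fun j => ?_⟩
  rw [X.chart_smul S _ _ hp, hv, ← hw]
  by_cases h : w j = 0
  · simp [h]
  · simp [h]

theorem ToricManifold.mem_target_of_ne_zero (S : Sg.cones) {w : Cm m} {p : M}
    (hp : p ∈ (X.chart S).source) (h : ∀ j, X.chart S p j ≠ 0 → w j ≠ 0) :
    w ∈ (X.chart S).target := by
  have h1 := (X.chart S).map_source hp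
  rw [X.chart_target] at h1 ⊢
  exact fun j hj => h j (h1 j hj)

theorem ToricManifold.exists_ray_of_eq_zero (S : Sg.cones) {p : M}
    (hp : p ∈ (X.chart S).source) {j : Fin m} (h : X.chart S p j = 0) :
    ∃ i : S.1, X.idx S i = j := by
  have h1 := (X.chart S).map_source hp
  rw [X.chart_target] at h1
  by_contra hj
  exact h1 j (fun ⟨i, hi⟩ => hj ⟨i, hi⟩) h

theorem ToricManifold.fundCoord_ray (S : Sg.cones) (i : S.1) (w : Cm m) :
    X.fundCoord S (intVec (Sg.ray i)) w
      = Pi.single (X.idx S i) (2 * Real.pi * Complex.I * w (X.idx S i)) := by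
  funext j
  rw [ToricManifold.fundCoord, ← X.basis_idx S i, dualCoord_intVec_self]
  by_cases h : X.idx S i = j
  · subst h
    simp
  · simp [h, Ne.symm h]

end OpenOrbit

/-! ### Minima of the moment map components and the facets of the polytope -/

section Polytope

variable {m d : ℕ} {Sg : SmoothFan m d} {M : Type*} [TopologicalSpace M]
  [ChartedSpace (Cm m) M] [MulAction (CTorus m) M] {X : ToricManifold Sg M} (K : ToricKahler X)

/-- The derivative of `⟨μ, v⟩` along the segment is `-ω(v_w, b - a)`, so the sign condition makes it
monotone. -/
theorem ToricKahler.pair_mu_le_of_segment (S : Sg.cones) (v : Lie m) (a b : Cm m)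
    (ht : ∀ t ∈ Set.Icc (0 : ℝ) 1, a + t • (b - a) ∈ (X.chart S).target)
    (hd : ∀ t ∈ Set.Icc (0 : ℝ) 1, ∀ (q : M) (hq : q ∈ (X.chart S).source),
      X.chart S q = a + t • (b - a) →
        K.chartForm S q hq (X.fundCoord S v (a + t • (b - a))) (b - a) ≤ 0) :
    pair (K.mu ((X.chart S).symm a)) v ≤ pair (K.mu ((X.chart S).symm b)) v := by
  set f : Cm m → ℝ := fun w => pair (K.mu ((X.chart S).symm w)) v with hf
  have hder : ∀ t ∈ Set.Icc (0 : ℝ) 1, ∃ f' : ℝ, 0 ≤ f' ∧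
      HasDerivAt (fun t : ℝ => f (a + t • (b - a))) f' t := by
    intro t htt
    have hq := (X.chart S).map_target (ht t htt)
    have hr := (X.chart S).right_inv (ht t htt)
    have h1 := K.hasFDerivAt_mu_chart S hq v
    rw [hr] at h1
    have h2 : HasDerivAt (fun t : ℝ => a + t • (b - a)) (b - a) t := by
      simpa using ((hasDerivAt_id t).smul_const (b - a)).const_add a
    refine ⟨_, ?_, HasFDerivAt.comp_hasDerivAt (l := f) t h1 h2⟩
    have h3 := hd t htt _ hq hr
    simpa using h3
  have hm : MonotoneOn (fun t : ℝ => f (a + t • (b - a))) (Set.Icc 0 1) := by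
    refine monotoneOn_of_deriv_nonneg (convex_Icc 0 1) ?_ ?_ ?_
    · intro t htt
      obtain ⟨f', -, h⟩ := hder t htt
      exact h.continuousAt.continuousWithinAt
    · intro t htt
      obtain ⟨f', -, h⟩ := hder t (interior_subset htt)
      exact h.differentiableAt.differentiableWithinAt
    · intro t htt
      obtain ⟨f', h0, h⟩ := hder t (interior_subset htt)
      rwa [h.deriv]
  have := hm (Set.left_mem_Icc.2 zero_le_one) (Set.right_mem_Icc.2 zero_le_one) zero_le_one
  simpa [hf] using this

/-- By density take `q` in the open orbit, and by invariance of `μ` rotate both points to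
nonnegative coordinates, so that straight segments stay inside the chart. The path goes from `a` to
`b`, the projection of `c` to `w_j = 0`, where the fundamental vector of `λ_i` vanishes and the
component is constant. It then goes from `b` to `c` in the direction `∂_j`, where that vector is a
nonnegative multiple of `i(c - b)` and positivity makes the component nondecreasing. -/
theorem ToricKahler.pair_mu_le_of_chart_eq_zero (S : Sg.cones) (i : S.1) {p : M}
    (hp : p ∈ (X.chart S).source) (h0 : X.chart S p (X.idx S i) = 0) (q : M) :
    pair (K.mu p) (intVec (Sg.ray i)) ≤ pair (K.mu q) (intVec (Sg.ray i)) := by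
  set j := X.idx S i with hj
  have hcl : IsClosed {q | pair (K.mu p) (intVec (Sg.ray i)) ≤ pair (K.mu q) (intVec (Sg.ray i))} :=
    isClosed_le continuous_const ((continuous_pair_left _).comp K.mu_smooth.continuous)
  refine closure_minimal ?_ hcl (X.mem_closure_orbit q)
  rintro _ ⟨z, rfl⟩
  set q := cexpT z • X.base
  have hq : q ∈ (X.chart S).source := X.smul_mem_source S _ _ (X.base_mem_source S)
  have hqne : ∀ k, X.chart S q k ≠ 0 := by
    intro k
    rw [X.chart_smul S _ _ (X.base_mem_source S), X.chart_base]
    simp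
  change pair (K.mu p) (intVec (Sg.ray i)) ≤ pair (K.mu q) (intVec (Sg.ray i))
  obtain ⟨v, hv⟩ := X.exists_expT_smul_norm S hp
  obtain ⟨u, hu⟩ := X.exists_expT_smul_norm S hq
  rw [← K.mu_invariant v p, ← K.mu_invariant u q]
  have hp' := X.smul_mem_source S (expT v) p hp
  have hq' := X.smul_mem_source S (expT u) q hq
  set a : Cm m := fun k => (‖X.chart S p k‖ : ℂ) with ha
  set c : Cm m := fun k => (‖X.chart S q k‖ : ℂ) with hc
  set b : Cm m := Function.update c j 0 with hb
  have hpa : expT v • p = (X.chart S).symm a := by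
    rw [← (X.chart S).left_inv hp']
    exact congrArg _ (funext hv)
  have hqc : expT u • q = (X.chart S).symm c := by
    rw [← (X.chart S).left_inv hq']
    exact congrArg _ (funext hu)
  rw [hpa, hqc]
  have haj : a j = 0 := by simp [ha, h0]
  have hbj : b j = 0 := by simp [hb]
  have hrange : ∀ k, k ∉ Set.range (X.idx S) → k ≠ j ∧ X.chart S p k ≠ 0 := by
    intro k hk
    refine ⟨fun h => hk ⟨i, by rw [h]⟩, ?_⟩
    have h1 := (X.chart S).map_source hp
    rw [X.chart_target] at h1
    exact h1 k hk
  refine (K.pair_mu_le_of_segment S _ a b ?_ ?_).trans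
    (K.pair_mu_le_of_segment S _ b c ?_ ?_)
  · intro t ht
    rw [X.chart_target]
    intro k hk
    obtain ⟨hkj, hpk⟩ := hrange k hk
    have h1 : (a + t • (b - a)) k
        = (((1 - t) * ‖X.chart S p k‖ + t * ‖X.chart S q k‖ : ℝ) : ℂ) := by
      simp [ha, hb, hc, hkj]
      ring
    rw [h1]
    have h2 := norm_pos_iff.2 hpk
    have h3 := norm_pos_iff.2 (hqne k)
    have h4 : 0 < (1 - t) * ‖X.chart S p k‖ + t * ‖X.chart S q k‖ := by
      rcases eq_or_lt_of_le ht.1 with h | h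
      · rw [← h]
        simpa using h2
      · have := mul_pos h h3
        have := mul_nonneg (sub_nonneg.2 ht.2) h2.le
        linarith
    exact_mod_cast h4.ne'
  · intro t ht q' hq' _
    rw [X.fundCoord_ray]
    have h1 : (a + t • (b - a)) (X.idx S i) = 0 := by
      rw [← hj]
      simp [haj, hbj]
    rw [h1]
    simp
  · intro t ht
    rw [X.chart_target]
    intro k hk
    obtain ⟨hkj, hpk⟩ := hrange k hk
    have h1 : (b + t • (c - b)) k = c k := by simp [hb, hkj]
    rw [h1, hc]
    simpa using hqne k
  · intro t ht q' hq' _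
    have h1 : c - b = Pi.single j (c j) := by
      funext k
      by_cases hk : k = j
      · subst hk
        simp [hb]
      · simp [hb, hk]
    have h2 : X.fundCoord S (intVec (Sg.ray i)) (b + t • (c - b))
        = (2 * Real.pi * t) • (Complex.I • (c - b)) := by
      rw [X.fundCoord_ray, ← hj, h1]
      funext k
      by_cases hk : k = j
      · subst hk
        simp [hbj]
        ring
      · simp [hk]
    rw [h2, map_smul, LinearMap.smul_apply, smul_eq_mul, K.chartForm_swap]
    have h3 := K.chartForm_nonneg S hq' (c - b)
    have h4 : 0 ≤ 2 * Real.pi * t := mul_nonneg (by positivity) ht.1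
    nlinarith [mul_nonneg h4 h3]

/-- At a minimum `ω(v_p, ·)` vanishes; evaluating it on `i v_p` contradicts positivity unless `v_p =
0`. -/
theorem ToricKahler.fundCoord_eq_zero_of_min (S : Sg.cones) {p : M}
    (hp : p ∈ (X.chart S).source) (v : Lie m)
    (h : ∀ q, pair (K.mu p) v ≤ pair (K.mu q) v) : X.fundCoord S v (X.chart S p) = 0 := by
  have h1 := K.hasFDerivAt_mu_chart S hp v
  have h2 : IsLocalMin (fun w => pair (K.mu ((X.chart S).symm w)) v) (X.chart S p) := by
    refine Filter.Eventually.of_forall fun w => ?_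
    simp only [(X.chart S).left_inv hp]
    exact h _
  have h3 := h2.hasFDerivAt_eq_zero h1
  by_contra hne
  have h4 := K.chartForm_pos S hp hne
  have h5 := congrArg (fun A : Cm m →L[ℝ] ℝ =>
    A (Complex.I • X.fundCoord S v (X.chart S p))) h3
  simp at h5
  linarith

theorem ToricKahler.kappa_le (q : M) (i : Fin d) :
    K.kappa i ≤ pair (K.mu q) (intVec (Sg.ray i)) := by
  have h : K.mu q ∈ closure (Set.range K.mu) := subset_closure ⟨q, rfl⟩
  rw [K.closure_polytope] at h
  exact Set.mem_iInter.1 h i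

theorem ToricManifold.dualCoord_eq_zero_of_fundCoord (S : Sg.cones) {v : Lie m} {w : Cm m}
    (h : X.fundCoord S v w = 0) {j : Fin m} (hj : w j ≠ 0) : dualCoord (X.basis S) j v = 0 := by
  have h1 := congrFun h j
  have hpi : (Real.pi : ℂ) ≠ 0 := by exact_mod_cast Real.pi_ne_zero
  simpa [ToricManifold.fundCoord, hj, hpi] using h1

theorem SmoothFan.intVec_ray_ne_zero (Sg : SmoothFan m d) (i : Fin d) :
    intVec (Sg.ray i) ≠ 0 := by
  obtain ⟨b, e, h⟩ := Sg.smooth {i} (Sg.singleton_mem i)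
  intro h0
  have h1 : Sg.ray i = 0 := by
    funext k
    have := congrArg (fun v : Lie m => v k) h0
    simpa [intVec] using this
  exact b.ne_zero (e ⟨i, by simp⟩) ((h _).trans h1)

/-- The cones of two distinct rays meet in the cone of `∅`, which is `0`. -/
theorem SmoothFan.ray_ne_of_smul (Sg : SmoothFan m d) {i k : Fin d} (hik : k ≠ i) {a : ℝ}
    (ha : 0 ≤ a) : intVec (Sg.ray k) ≠ a • intVec (Sg.ray i) := by
  intro h
  have h1 : intVec (Sg.ray k) ∈ coneOf Sg.ray {i} ∩ coneOf Sg.ray {k} :=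
    ⟨⟨fun _ => a, fun _ => ha, by simpa using h⟩, ⟨fun _ => 1, fun _ => zero_le_one, by simp⟩⟩
  rw [Sg.inter_eq _ (Sg.singleton_mem i) _ (Sg.singleton_mem k)] at h1
  have h2 : ({i} : Finset (Fin d)) ∩ {k} = ∅ := by
    rw [Finset.singleton_inter_of_notMem]
    simpa using hik.symm
  rw [h2] at h1
  obtain ⟨_, -, h3⟩ := h1
  exact Sg.intVec_ray_ne_zero k (by simpa using h3)

/-- On the divisor `w_j = 0` the component `⟨μ, λ_i⟩` attains its minimum over `M`. If this minimum
exceeded `κ_i`, the image of a generic point of the divisor would satisfy all the inequalities of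
the polytope strictly. A small move by `-ε λ_i` would then stay in the closure of `Δ` while going
below the minimum. -/
theorem ToricKahler.kappa_eq (S : Sg.cones) (i : S.1) {p : M}
    (hp : p ∈ (X.chart S).source) (h0 : X.chart S p (X.idx S i) = 0) :
    pair (K.mu p) (intVec (Sg.ray i)) = K.kappa i := by
  obtain ⟨i, hiS⟩ := i
  change pair (K.mu p) (intVec (Sg.ray i)) = K.kappa i
  set v := intVec (Sg.ray i) with hv
  refine le_antisymm ?_ (K.kappa_le p i)
  by_contra! hlt
  -- a generic point of the divisor of `i`
  set T : Sg.cones := ⟨{i}, Sg.singleton_mem i⟩ with hT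
  set iT : T.1 := ⟨i, Finset.mem_singleton_self i⟩ with hiT
  set j := X.idx T iT with hj
  have hbj : X.basis T j = Sg.ray i := X.basis_idx T iT
  -- In the chart of the single ray `λ_i`, the point with `w_j = 0` and all other coordinates `1`
  -- lies on no other divisor.
  set w : Cm m := Function.update 1 j 0 with hw
  have hwt : w ∈ (X.chart T).target := by
    rw [X.chart_target]
    intro k hk
    have : k ≠ j := fun h => hk ⟨iT, h ▸ rfl⟩
    simp [hw, this]
  set p0 := (X.chart T).symm w with hp0
  have hp0s : p0 ∈ (X.chart T).source := (X.chart T).map_target hwt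
  have hp0w : X.chart T p0 = w := (X.chart T).right_inv hwt
  have hmin : ∀ q, pair (K.mu p0) v ≤ pair (K.mu q) v :=
    K.pair_mu_le_of_chart_eq_zero T iT hp0s (by rw [hp0w]; simp [hw, hj])
  have hmin' : ∀ q, pair (K.mu p) v ≤ pair (K.mu q) v :=
    K.pair_mu_le_of_chart_eq_zero S ⟨i, hiS⟩ hp h0
  have hlt0 : K.kappa i < pair (K.mu p0) v := hlt.trans_le (hmin' p0)
  have hstrict : ∀ k, K.kappa k < pair (K.mu p0) (intVec (Sg.ray k)) := by
    intro k
    by_cases hk : k = i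
    · rw [hk]
      exact hlt0
    refine lt_of_le_of_ne (K.kappa_le p0 k) fun heq => ?_
    have hmink : ∀ q, pair (K.mu p0) (intVec (Sg.ray k)) ≤ pair (K.mu q) (intVec (Sg.ray k)) :=
      fun q => heq ▸ K.kappa_le q k
    have h1 := K.fundCoord_eq_zero_of_min T hp0s _ hmink
    rw [hp0w] at h1
    -- Equality for `k` makes `p0` a minimum of `⟨μ, λ_k⟩`, so `λ_k` stabilises `p0`. Only `w_j`
    -- vanishes there, hence `λ_k` is a multiple of `λ_i`.
    have h2 : intVec (Sg.ray k) = dualCoord (X.basis T) j (intVec (Sg.ray k)) • v := by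
      conv_lhs => rw [← sum_dualCoord_smul (X.basis T) (intVec (Sg.ray k))]
      rw [Finset.sum_eq_single j, hbj]
      · intro l _ hl
        rw [X.dualCoord_eq_zero_of_fundCoord T h1 (by simp [hw, hl]), zero_smul]
      · simp
    set a := dualCoord (X.basis T) j (intVec (Sg.ray k))
    rcases le_or_gt 0 a with ha | ha
    · exact Sg.ray_ne_of_smul hk ha h2
    -- If `λ_k = a λ_i` with `a < 0`, then `p0` also maximises `⟨μ, λ_i⟩`, so the component is
    -- constant and `λ_i` would stabilise the base point of the free orbit.
    · have hconst : ∀ q, pair (K.mu X.base) v ≤ pair (K.mu q) v := by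
        intro q
        have h3 := hmink X.base
        rw [h2, pair_smul_right, pair_smul_right] at h3
        exact ((mul_le_mul_left_of_neg ha).1 h3).trans (hmin q)
      have h4 := K.fundCoord_eq_zero_of_min T (X.base_mem_source T) _ hconst
      have h5 := X.dualCoord_eq_zero_of_fundCoord T h4 (j := j) (by simp [X.chart_base])
      rw [hv, ← hbj, dualCoord_intVec_self] at h5
      simp at h5
  have hcont : ∀ᶠ ε : ℝ in 𝓝[>] 0, ∀ k, K.kappa k ≤ pair (K.mu p0 - ε • v) (intVec (Sg.ray k)) := by
    rw [Filter.eventually_all]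
    intro k
    have h1 : Continuous fun ε : ℝ => pair (K.mu p0 - ε • v) (intVec (Sg.ray k)) :=
      (continuous_pair_left _).comp (by fun_prop)
    have h2 := h1.tendsto 0
    simp only [zero_smul, sub_zero] at h2
    exact ((h2.eventually (lt_mem_nhds (hstrict k))).mono fun ε h => h.le).filter_mono
      nhdsWithin_le_nhds
  obtain ⟨ε, hε, hε0⟩ := (hcont.and self_mem_nhdsWithin).exists
  have hmem : K.mu p0 - ε • v ∈ closure (Set.range K.mu) := by
    rw [K.closure_polytope]
    exact Set.mem_iInter.2 hε
  have hcl : IsClosed {y : Lie m | pair (K.mu p0) v ≤ pair y v} :=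
    isClosed_le continuous_const (continuous_pair_left _)
  have h1 := closure_minimal (by rintro _ ⟨q, rfl⟩; exact hmin q) hcl hmem
  have h2 : pair (K.mu p0) v ≤ pair (K.mu p0 - ε • v) v := h1
  rw [pair_sub_smul_left] at h2
  have h3 := mul_pos (show (0 : ℝ) < ε from hε0) (pair_self_pos (Sg.intVec_ray_ne_zero i))
  rw [← hv] at h3
  linarith

/-- The infinitesimal stabiliser of `p` is contained in `𝔷_{μ(p)}`. -/
theorem ToricKahler.mem_stabSpan (S : Sg.cones) {p : M} (hp : p ∈ (X.chart S).source) {v : Lie m}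
    (h : X.fundCoord S v (X.chart S p) = 0) : v ∈ K.stabSpan (K.mu p) := by
  -- A term of the expansion survives only where `w_j = 0`, and then `b_j` is a ray on whose facet
  -- `μ(p)` lies.
  rw [← sum_dualCoord_smul (X.basis S) v]
  refine Submodule.sum_mem _ fun j _ => ?_
  by_cases hj : X.chart S p j = 0
  · obtain ⟨i, hi⟩ := X.exists_ray_of_eq_zero S hp hj
    refine Submodule.smul_mem _ _ (Submodule.subset_span ⟨i, ?_, ?_⟩)
    · exact K.kappa_eq S i hp (by rw [hi, hj])
    · rw [← hi, X.basis_idx]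
  · rw [X.dualCoord_eq_zero_of_fundCoord S h hj, zero_smul]
    exact Submodule.zero_mem _

end Polytope

/-! ### The real form in affine toric charts -/

section RealForm

variable {m d : ℕ} {Sg : SmoothFan m d} {M : Type*} [TopologicalSpace M] [T2Space M]
  [ChartedSpace (Cm m) M] [MulAction (CTorus m) M] (X : ToricManifold Sg M)

/-- The involution `σ` is complex conjugation in every affine toric chart. -/
theorem ToricManifold.conj_eq_of_mem_source (S : Sg.cones) {p : M}
    (hp : p ∈ (X.chart S).source) :
    X.conj p = (X.chart S).symm fun j => (starRingEnd ℂ) (X.chart S p j) := by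
  set s : Sg.cones → M → M := fun T q =>
    (X.chart T).symm fun j => (starRingEnd ℂ) (X.chart T q j) with hs
  have hcont : ∀ T, p ∈ (X.chart T).source → ContinuousAt (s T) p := by
    intro T hT
    refine ContinuousAt.comp (g := (X.chart T).symm) ?_ ?_
    · refine (X.chart T).continuousAt_symm (X.mem_target_of_ne_zero T hT fun j hj => ?_)
      simpa using hj
    · refine ContinuousAt.comp (g := fun w : Cm m => fun j => (starRingEnd ℂ) (w j)) ?_
        ((X.chart T).continuousAt hT)
      refine Continuous.continuousAt (continuous_pi fun j => ?_)
      exact Complex.continuous_conj.comp (continuous_apply j)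
  have horbit : ∀ T (z : Cm m), s T (cexpT z • X.base) = conjT (cexpT z) • X.base := by
    intro T z
    have h1 : (fun j => (starRingEnd ℂ) (X.chart T (cexpT z • X.base) j))
        = X.chart T (conjT (cexpT z) • X.base) := by
      funext j
      rw [X.chart_smul T _ _ (X.base_mem_source T), X.chart_smul T _ _ (X.base_mem_source T),
        dualChar_conjT, X.chart_base]
      simp
    simp only [hs]
    rw [h1]
    exact (X.chart T).left_inv (X.smul_mem_source T _ _ (X.base_mem_source T))
  change s (X.coneAt p) p = s S p
  by_contra hne
  -- In a Hausdorff space, two maps continuous at `p` with different values there differ near `p`;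
  -- but both conjugations agree on the orbit, which is dense.
  have h1 : ∀ᶠ q in 𝓝 p, s (X.coneAt p) q ≠ s S q :=
    ((hcont _ (X.mem_source_coneAt p)).ne_iff_eventually_ne (hcont S hp)).1 hne
  obtain ⟨q, hq, z, rfl⟩ := mem_closure_iff_nhds.1 (X.mem_closure_orbit p) _ h1
  exact hq ((horbit _ z).trans (horbit S z).symm)

theorem ToricManifold.mem_realForm_iff (S : Sg.cones) {p : M} (hp : p ∈ (X.chart S).source) :
    p ∈ X.realForm ↔ ∀ j, (X.chart S p j).im = 0 := by
  have ht : (fun j => (starRingEnd ℂ) (X.chart S p j)) ∈ (X.chart S).target :=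
    X.mem_target_of_ne_zero S hp fun j hj => by simpa using hj
  rw [ToricManifold.realForm, Set.mem_ofPred_eq, X.conj_eq_of_mem_source S hp]
  constructor
  · intro h j
    have h1 := congrArg (X.chart S) h
    rw [(X.chart S).right_inv ht] at h1
    exact Complex.conj_eq_iff_im.1 (congrFun h1 j)
  · intro h
    have h1 : (fun j => (starRingEnd ℂ) (X.chart S p j)) = X.chart S p :=
      funext fun j => Complex.conj_eq_iff_im.2 (h j)
    rw [h1, (X.chart S).left_inv hp]

/-- A preimage of `y` is rotated by the real torus to nonnegative, hence real, coordinates; `μ` does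
not change. -/
theorem ToricKahler.realLevel_nonempty {X : ToricManifold Sg M} (K : ToricKahler X) {n : ℕ}
    (ζ : Fin n → Lie m) (c : Fin n → ℝ)
    (hint : ∃ y ∈ interior (Set.range K.mu), ∀ i, pair y (ζ i) = c i) :
    (K.realLevel ζ c).Nonempty := by
  obtain ⟨y, hy, hyc⟩ := hint
  obtain ⟨p, rfl⟩ := interior_subset hy
  obtain ⟨S, hp⟩ := X.cover p
  obtain ⟨v, hv⟩ := X.exists_expT_smul_norm S hp
  refine ⟨expT v • p, ?_, fun i => by rw [K.mu_invariant, hyc]⟩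
  rw [X.mem_realForm_iff S (X.smul_mem_source S _ _ hp)]
  intro j
  rw [hv]
  simp

end RealForm

/-! ### Regular level sets -/

section SliceCharts

variable {m k : ℕ} {M : Type*} [TopologicalSpace M] [ChartedSpace (Cm m) M]
  {F : Type*} [NormedAddCommGroup F] [NormedSpace ℝ F]

/-- A chart of `M` around `p` with values in `F × ℝ^k` in which `S` is the slice `{0} × ℝ^k`. -/
structure SliceChart (m k : ℕ) {M : Type*} [TopologicalSpace M] [ChartedSpace (Cm m) M]
    (F : Type*) [NormedAddCommGroup F] [NormedSpace ℝ F] (S : Set M) (p : M) where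
  toHomeo : OpenPartialHomeomorph M (F × EuclideanSpace ℝ (Fin k))
  mem_source : p ∈ toHomeo.source
  contMDiffOn : ContMDiffOn 𝓘(ℝ, Cm m) 𝓘(ℝ, F × EuclideanSpace ℝ (Fin k)) ∞ toHomeo toHomeo.source
  contMDiffOn_symm : ContMDiffOn 𝓘(ℝ, F × EuclideanSpace ℝ (Fin k)) 𝓘(ℝ, Cm m) ∞ toHomeo.symm
    toHomeo.target
  mem_iff : ∀ q ∈ toHomeo.source, q ∈ S ↔ (toHomeo q).1 = 0

variable {S : Set M}

open Classical in
/-- The chart of `S` defined by a slice chart. -/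
def SliceChart.restrict {p : S} (Φ : SliceChart m k F S (p : M)) :
    OpenPartialHomeomorph S (EuclideanSpace ℝ (Fin k)) where
  toFun q := (Φ.toHomeo q).2
  -- Off the target the value is irrelevant; `p` is a default at hand in `S`.
  invFun x := if h : ((0 : F), x) ∈ Φ.toHomeo.target then
    ⟨Φ.toHomeo.symm (0, x), (Φ.mem_iff _ (Φ.toHomeo.map_target h)).2 (by
      rw [Φ.toHomeo.right_inv h])⟩ else p
  source := Subtype.val ⁻¹' Φ.toHomeo.source
  target := {x | ((0 : F), x) ∈ Φ.toHomeo.target}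
  map_source' q hq := by
    have h1 : (0, (Φ.toHomeo q).2) = Φ.toHomeo q :=
      Prod.ext ((Φ.mem_iff _ hq).1 q.2).symm rfl
    change (0, (Φ.toHomeo q).2) ∈ Φ.toHomeo.target
    rw [h1]
    exact Φ.toHomeo.map_source hq
  map_target' x hx := by
    have hx' : ((0 : F), x) ∈ Φ.toHomeo.target := hx
    rw [dif_pos hx']
    exact Φ.toHomeo.map_target hx'
  left_inv' q hq := by
    have h1 : (0, (Φ.toHomeo q).2) = Φ.toHomeo q :=
      Prod.ext ((Φ.mem_iff _ hq).1 q.2).symm rfl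
    have h2 : (0, (Φ.toHomeo q).2) ∈ Φ.toHomeo.target := by
      rw [h1]
      exact Φ.toHomeo.map_source hq
    rw [dif_pos h2]
    refine Subtype.ext ?_
    change Φ.toHomeo.symm (0, (Φ.toHomeo q).2) = q
    rw [h1, Φ.toHomeo.left_inv hq]
  right_inv' x hx := by
    have hx' : ((0 : F), x) ∈ Φ.toHomeo.target := hx
    rw [dif_pos hx']
    change (Φ.toHomeo (Φ.toHomeo.symm (0, x))).2 = x
    rw [Φ.toHomeo.right_inv hx']
  open_source := Φ.toHomeo.open_source.preimage continuous_subtype_val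
  open_target := Φ.toHomeo.open_target.preimage (by fun_prop)
  continuousOn_toFun := continuous_snd.comp_continuousOn
    (Φ.toHomeo.continuousOn.comp continuous_subtype_val.continuousOn fun _ h => h)
  continuousOn_invFun := by
    rw [Topology.IsInducing.subtypeVal.continuousOn_iff]
    have h1 : ContinuousOn (fun x => Φ.toHomeo.symm ((0 : F), x))
        {x | ((0 : F), x) ∈ Φ.toHomeo.target} :=
      Φ.toHomeo.continuousOn_symm.comp (by fun_prop) fun _ h => h
    refine h1.congr fun x hx => ?_
    have hx' : ((0 : F), x) ∈ Φ.toHomeo.target := hx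
    simp only [Function.comp_apply]
    rw [dif_pos hx']

open Classical in
theorem SliceChart.coe_restrict_symm {p : S} (Φ : SliceChart m k F S (p : M))
    {x : EuclideanSpace ℝ (Fin k)} (hx : x ∈ Φ.restrict.target) :
    (Φ.restrict.symm x : M) = Φ.toHomeo.symm (0, x) := by
  have hx' : ((0 : F), x) ∈ Φ.toHomeo.target := hx
  change ((if h : ((0 : F), x) ∈ Φ.toHomeo.target then _ else p : S) : M) = _
  rw [dif_pos hx']

/-- A subset of `M` that has slice charts around all its points is a submanifold. -/
def embeddedSubmanifoldOfSliceCharts (Φ : ∀ p : S, SliceChart m k F S (p : M)) :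
    EmbeddedSubmanifold m S k := by
  letI C : ChartedSpace (EuclideanSpace ℝ (Fin k)) S :=
    { atlas := Set.range fun p => (Φ p).restrict
      chartAt := fun p => (Φ p).restrict
      mem_chart_source := fun p => (Φ p).mem_source
      chart_mem_atlas := fun p => ⟨p, rfl⟩ }
  have hM : IsManifold (𝓡 k) ∞ S := by
    refine isManifold_of_contDiffOn _ _ _ ?_
    rintro _ _ ⟨p, rfl⟩ ⟨q, rfl⟩
    simp only [modelWithCornersSelf_coe, modelWithCornersSelf_coe_symm, Function.comp_id,
      Function.id_comp, Set.range_id, Set.inter_univ, Set.preimage_id]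
    have h1 : ContMDiffOn 𝓘(ℝ, EuclideanSpace ℝ (Fin k)) 𝓘(ℝ, F × EuclideanSpace ℝ (Fin k)) ∞
        (fun x => (Φ q).toHomeo ((Φ p).toHomeo.symm ((0 : F), x)))
        ((Φ p).restrict.symm.trans (Φ q).restrict).source := by
      refine (Φ q).contMDiffOn.comp (t := (Φ q).toHomeo.source)
        ((Φ p).contMDiffOn_symm.comp (t := (Φ p).toHomeo.target) ?_ ?_) ?_
      · refine ContDiff.contMDiff ?_ |>.contMDiffOn
        fun_prop
      · exact fun x hx => hx.1
      · intro x hx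
        have h2 : (Φ p).restrict.symm x ∈ (Φ q).restrict.source := hx.2
        have h3 : ((Φ p).restrict.symm x : M) ∈ (Φ q).toHomeo.source := h2
        rwa [(Φ p).coe_restrict_symm hx.1] at h3
    refine ((contDiff_snd.comp_contDiffOn (contMDiffOn_iff_contDiffOn.1 h1))).congr ?_
    intro x hx
    change ((Φ q).toHomeo ((Φ p).restrict.symm x : M)).2 = _
    rw [(Φ p).coe_restrict_symm hx.1]
    rfl
  have hchart : ∀ p : S, ContMDiffAt (𝓡 k) (𝓡 k) ∞ (Φ p).restrict p := fun p =>
    contMDiffAt_of_mem_maximalAtlas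
      (IsManifold.subset_maximalAtlas ⟨p, rfl⟩) (Φ p).mem_source
  have hval : ContMDiff (𝓡 k) 𝓘(ℝ, Cm m) ∞ (Subtype.val : S → M) := by
    intro p
    have h1 : (Subtype.val : S → M) =ᶠ[𝓝 p]
        fun q => (Φ p).toHomeo.symm ((0 : F), (Φ p).restrict q) := by
      filter_upwards [(Φ p).restrict.open_source.mem_nhds (Φ p).mem_source] with q hq
      rw [← (Φ p).coe_restrict_symm ((Φ p).restrict.map_source hq), (Φ p).restrict.left_inv hq]
    refine ContMDiffAt.congr_of_eventuallyEq ?_ h1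
    refine ContMDiffAt.comp (I' := 𝓘(ℝ, F × EuclideanSpace ℝ (Fin k))) p
      (g := (Φ p).toHomeo.symm) ((Φ p).contMDiffOn_symm.contMDiffAt
      ((Φ p).toHomeo.open_target.mem_nhds ((Φ p).restrict.map_source (Φ p).mem_source))) ?_
    refine ContMDiffAt.comp (I' := 𝓡 k) p (g := fun x : EuclideanSpace ℝ (Fin k) => ((0 : F), x)) ?_
      (hchart p)
    refine (ContDiff.contMDiff ?_).contMDiffAt
    fun_prop
  refine ⟨C, hM, hval, fun p => ?_⟩
  -- The second component of the slice chart, composed with the inclusion, is the chart of `S`. Its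
  -- differential is injective, and therefore so is that of the inclusion.
  have h1 : MDifferentiableAt 𝓘(ℝ, Cm m) (𝓡 k) (fun q => ((Φ p).toHomeo q).2) (p : M) := by
    have h2 := ((Φ p).contMDiffOn.contMDiffAt
      ((Φ p).toHomeo.open_source.mem_nhds (Φ p).mem_source)).mdifferentiableAt (by simp)
    refine MDifferentiableAt.comp (I' := 𝓘(ℝ, F × EuclideanSpace ℝ (Fin k))) (p : M)
      (g := Prod.snd) ?_ h2
    exact differentiableAt_snd.mdifferentiableAt
  have h2 := mfderiv_comp p h1 (hval.contMDiffAt.mdifferentiableAt (by simp))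
  have h3 : Function.Injective (mfderiv (𝓡 k) (𝓡 k) (Φ p).restrict p) :=
    (OpenPartialHomeomorph.MDifferentiable.mfderiv_bijective
      (mdifferentiable_of_mem_atlas (I := 𝓡 k) (e := (Φ p).restrict) ⟨p, rfl⟩)
      (Φ p).mem_source).1
  have h4 : ((fun q => ((Φ p).toHomeo q).2) ∘ (Subtype.val : S → M)) = (Φ p).restrict := rfl
  rw [h4] at h2
  intro Y Z hYZ
  refine h3 ?_
  rw [h2]
  exact congrArg (mfderiv 𝓘(ℝ, Cm m) (𝓡 k) (fun q => ((Φ p).toHomeo q).2) (p : M)) hYZ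

variable [FiniteDimensional ℝ F]

/-- Implicit function theorem: `g` together with a projection to the kernel of its differential at
`e p` is a local diffeomorphism of `ℂ^m`, of real dimension `2m`. -/
theorem exists_sliceChart_of_regular {e : OpenPartialHomeomorph M (Cm m)}
    (he : e ∈ IsManifold.maximalAtlas 𝓘(ℝ, Cm m) ∞ M) {p : M} (hp : p ∈ e.source)
    (g : Cm m → F) (hg : ContDiffOn ℝ ∞ g e.target)
    (hS : ∀ q ∈ e.source, q ∈ S ↔ g (e q) = 0)
    (hsurj : Function.Surjective (fderiv ℝ g (e p)))
    (hk : Module.finrank ℝ F + k = 2 * m) : Nonempty (SliceChart m k F S p) := by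
  set g' := fderiv ℝ g (e p) with hg'
  have hep := e.map_source hp
  have hker : Module.finrank ℝ (LinearMap.ker g'.toLinearMap)
      = Module.finrank ℝ (EuclideanSpace ℝ (Fin k)) := by
    have h1 := LinearMap.finrank_range_add_finrank_ker g'.toLinearMap
    rw [LinearMap.range_eq_top.2 hsurj, finrank_top] at h1
    have h2 : Module.finrank ℝ (Cm m) = 2 * m := by
      simp [Module.finrank_pi_fintype, mul_comm]
    rw [finrank_euclideanSpace_fin]
    omega
  obtain ⟨π, hπ⟩ := Submodule.ClosedComplemented.of_finiteDimensional (LinearMap.ker g'.toLinearMap)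
  set l : LinearMap.ker g'.toLinearMap ≃ₗ[ℝ] EuclideanSpace ℝ (Fin k) := LinearEquiv.ofFinrankEq _ _ hker
  set P : Cm m →L[ℝ] EuclideanSpace ℝ (Fin k) := (l.toContinuousLinearEquiv :
    LinearMap.ker g'.toLinearMap →L[ℝ] EuclideanSpace ℝ (Fin k)).comp π with hP
  set φ : Cm m → F × EuclideanSpace ℝ (Fin k) := fun w => (g w, P w) with hφ
  have hφs : ContDiffOn ℝ ∞ φ e.target := hg.prodMk P.contDiff.contDiffOn
  have hφat : ∀ w ∈ e.target, ContDiffAt ℝ ∞ φ w := fun w hw =>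
    hφs.contDiffAt (e.open_target.mem_nhds hw)
  have hinj : Function.Injective (g'.prod P) := by
    rw [injective_iff_map_eq_zero]
    intro w hw
    have h1 : g' w = 0 := congrArg Prod.fst hw
    have h2 : l (π w) = 0 := congrArg Prod.snd hw
    have h3 : π w = ⟨w, h1⟩ := hπ ⟨w, h1⟩
    rw [h3] at h2
    have h4 := l.map_eq_zero_iff.1 h2
    exact congrArg Subtype.val h4
  have hdim : Module.finrank ℝ (Cm m) = Module.finrank ℝ (F × EuclideanSpace ℝ (Fin k)) := by
    have h2 : Module.finrank ℝ (Cm m) = 2 * m := by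
      simp [Module.finrank_pi_fintype, mul_comm]
    rw [Module.finrank_prod, finrank_euclideanSpace_fin, h2, hk]
  set A : Cm m ≃L[ℝ] F × EuclideanSpace ℝ (Fin k) :=
    (LinearEquiv.ofInjectiveOfFinrankEq (g'.prod P).toLinearMap hinj hdim).toContinuousLinearEquiv
    with hA
  have hAcoe : (A : Cm m →L[ℝ] F × EuclideanSpace ℝ (Fin k)) = g'.prod P := by
    ext1 w
    rfl
  have hstrict : HasStrictFDerivAt φ (A : Cm m →L[ℝ] F × EuclideanSpace ℝ (Fin k)) (e p) := by
    rw [hAcoe]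
    exact ((hg.contDiffAt (e.open_target.mem_nhds hep)).hasStrictFDerivAt (by simp)).prodMk
      P.hasStrictFDerivAt
  -- The local inverse is smooth wherever the differential of `φ` is invertible, an open condition;
  -- restricting to `U` makes it smooth on the whole target.
  set U : Set (Cm m) := {w ∈ e.target | fderiv ℝ φ w ∈ Set.range
    ((↑) : (Cm m ≃L[ℝ] F × EuclideanSpace ℝ (Fin k)) → Cm m →L[ℝ] F × EuclideanSpace ℝ (Fin k))}
    with hU
  have hUo : IsOpen U :=
    (hφs.continuousOn_fderiv_of_isOpen e.open_target (by simp)).isOpen_inter_preimage e.open_target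
      (ContinuousLinearEquiv.isOpen (E := Cm m) (F := F × EuclideanSpace ℝ (Fin k)))
  have hpU : e p ∈ U := ⟨hep, A, hstrict.hasFDerivAt.fderiv.symm⟩
  set Ψ := (hstrict.toOpenPartialHomeomorph φ).restr U with hΨ
  have hΨs : Ψ.source ⊆ U := by
    rw [hΨ, OpenPartialHomeomorph.restr_source, hUo.interior_eq]
    exact Set.inter_subset_right
  have hΨp : e p ∈ Ψ.source := by
    rw [hΨ, OpenPartialHomeomorph.restr_source, hUo.interior_eq]
    exact ⟨hstrict.mem_toOpenPartialHomeomorph_source, hpU⟩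
  have hΨsymm : ContDiffOn ℝ ∞ Ψ.symm Ψ.target := by
    intro x hx
    have h1 := hΨs (Ψ.map_target hx)
    obtain ⟨B, hB⟩ := h1.2
    refine (Ψ.contDiffAt_symm (f₀' := B) hx ?_ (hφat _ h1.1)).contDiffWithinAt
    rw [hB]
    exact ((hφat _ h1.1).differentiableAt (by simp)).hasFDerivAt
  refine ⟨⟨e.trans Ψ, ⟨hp, hΨp⟩, ?_, ?_, ?_⟩⟩
  · have h1 : ContMDiffOn 𝓘(ℝ, Cm m) 𝓘(ℝ, F × EuclideanSpace ℝ (Fin k)) ∞ φ e.target :=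
      contMDiffOn_iff_contDiffOn.2 hφs
    exact h1.comp ((contMDiffOn_of_mem_maximalAtlas he).mono fun q hq => hq.1)
      fun q hq => e.map_source hq.1
  · exact (contMDiffOn_symm_of_mem_maximalAtlas he).comp
      ((contMDiffOn_iff_contDiffOn.2 hΨsymm).mono fun x hx => hx.1) fun x hx => hx.2
  · exact fun q hq => hS q hq.1

theorem nonempty_embeddedSubmanifold_of_regular
    (h : ∀ p ∈ S, ∃ e ∈ IsManifold.maximalAtlas 𝓘(ℝ, Cm m) ∞ M, p ∈ e.source ∧
      ∃ g : Cm m → F, ContDiffOn ℝ ∞ g e.target ∧ (∀ q ∈ e.source, q ∈ S ↔ g (e q) = 0) ∧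
        Function.Surjective (fderiv ℝ g (e p)))
    (hk : Module.finrank ℝ F + k = 2 * m) : Nonempty (EmbeddedSubmanifold m S k) := by
  have h1 : ∀ p : S, Nonempty (SliceChart m k F S (p : M)) := by
    intro p
    obtain ⟨e, he, hp, g, hg, hS, hsurj⟩ := h p p.2
    exact exists_sliceChart_of_regular he hp g hg hS hsurj hk
  exact ⟨embeddedSubmanifoldOfSliceCharts fun p => (h1 p).some⟩

end SliceCharts

/-! ### The real level sets -/

section RealLevel

variable {m d n : ℕ} {Sg : SmoothFan m d} {M : Type*} [TopologicalSpace M]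
  [ChartedSpace (Cm m) M] [MulAction (CTorus m) M] {X : ToricManifold Sg M}

/-- The inclusion `ℝ^m ⊂ ℂ^m`. -/
def realVec (m : ℕ) : (Fin m → ℝ) →ₗ[ℝ] Cm m := Complex.ofRealCLM.toLinearMap.compLeft (Fin m)

theorem realVec_apply (x : Fin m → ℝ) (j : Fin m) : realVec m x j = (x j : ℂ) := rfl

/-- The fundamental vectors as a linear function of the Lie algebra. -/
def ToricManifold.fundLin (X : ToricManifold Sg M) (S : Sg.cones) (w : Cm m) : Lie m →ₗ[ℝ] Cm m where
  toFun v := X.fundCoord S v w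
  map_add' u v := by
    funext j
    simp [ToricManifold.fundCoord]
    ring
  map_smul' a v := by
    funext j
    simp [ToricManifold.fundCoord]
    ring

theorem ToricManifold.fundLin_apply (X : ToricManifold Sg M) (S : Sg.cones) (w : Cm m)
    (v : Lie m) : X.fundLin S w v = X.fundCoord S v w := rfl

/-- The real vectors `-i v_p`, where `p` is a real point. -/
def ToricManifold.realFund (X : ToricManifold Sg M) (S : Sg.cones) (w : Cm m) :
    Lie m →ₗ[ℝ] (Fin m → ℝ) :=
  LinearMap.pi fun j => (2 * Real.pi * (w j).re) • dualCoord (X.basis S) j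

theorem ToricManifold.fundCoord_eq_I_smul (X : ToricManifold Sg M) (S : Sg.cones) {w : Cm m}
    (hw : ∀ j, (w j).im = 0) (v : Lie m) :
    X.fundCoord S v w = Complex.I • realVec m (X.realFund S w v) := by
  funext j
  have h1 : ((w j).re : ℂ) = w j := Complex.ext (by simp) (by simp [hw j])
  simp only [ToricManifold.fundCoord, Pi.smul_apply, realVec_apply, ToricManifold.realFund,
    LinearMap.pi_apply, LinearMap.smul_apply, smul_eq_mul]
  push_cast
  rw [h1]
  ring

variable (K : ToricKahler X) {ζ : Fin n → Lie m} {c : Fin n → ℝ}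

theorem ToricKahler.eq_zero_of_fundCoord_eq_zero {p : M} (hreg : K.IsRegularPt ζ (K.mu p))
    (S : Sg.cones) (hp : p ∈ (X.chart S).source) {v : Lie m} (hv : v ∈ spanZeta ζ)
    (h : X.fundCoord S v (X.chart S p) = 0) : v = 0 := by
  have h1 : v ∈ spanZeta ζ ⊓ K.stabSpan (K.mu p) := ⟨hv, K.mem_stabSpan S hp h⟩
  rw [hreg] at h1
  exact (Submodule.mem_bot ℝ).1 h1

/-- Writing `v_p = i x` with `x` real, the hypothesis is `ω(ix, x) = 0`. Positivity gives `x = 0`,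
and regularity then gives `v = 0`. -/
theorem ToricKahler.eq_zero_of_chartForm_realFund {p : M} (hreg : K.IsRegularPt ζ (K.mu p))
    (S : Sg.cones) (hp : p ∈ (X.chart S).source) (hreal : ∀ j, (X.chart S p j).im = 0)
    {v : Lie m} (hv : v ∈ spanZeta ζ)
    (h : K.chartForm S p hp (X.fundCoord S v (X.chart S p))
      (realVec m (X.realFund S (X.chart S p) v)) = 0) : v = 0 := by
  refine K.eq_zero_of_fundCoord_eq_zero hreg S hp hv ?_
  rw [X.fundCoord_eq_I_smul S hreal, K.chartForm_swap, neg_eq_zero] at h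
  rw [X.fundCoord_eq_I_smul S hreal]
  by_contra hne
  have h1 : realVec m (X.realFund S (X.chart S p) v) ≠ 0 := by
    intro h0
    rw [h0, smul_zero] at hne
    exact hne rfl
  exact (K.chartForm_pos S hp h1).ne' h

/-- The map whose zero set is the real level set, in an affine toric chart. -/
def ToricKahler.levelMap (S : Sg.cones) (ζ : Fin n → Lie m) (c : Fin n → ℝ) (w : Cm m) :
    (Fin m → ℝ) × (Fin n → ℝ) :=
  (fun j => (w j).im, fun i => pair (K.mu ((X.chart S).symm w)) (ζ i) - c i)

theorem ToricKahler.contDiffOn_levelMap (S : Sg.cones) :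
    ContDiffOn ℝ ∞ (K.levelMap S ζ c) (X.chart S).target := by
  refine ContDiffOn.prodMk ?_ ?_
  · refine (contDiff_pi.2 fun j => ?_).contDiffOn
    exact Complex.imCLM.contDiff.comp (contDiff_apply ℝ ℂ j)
  · refine contDiffOn_pi.2 fun i => ContDiffOn.sub ?_ contDiffOn_const
    have h1 : ContMDiffOn 𝓘(ℝ, Cm m) 𝓘(ℝ, Lie m) ∞ (fun w => K.mu ((X.chart S).symm w))
        (X.chart S).target := K.mu_smooth.comp_contMDiffOn
          (contMDiffOn_symm_of_mem_maximalAtlas (X.chart_mem_real S))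
    have h2 : ContDiff ℝ ∞ fun y : Lie m => pair y (ζ i) := by
      unfold pair
      fun_prop
    exact h2.comp_contDiffOn (contMDiffOn_iff_contDiffOn.1 h1)

theorem ToricKahler.hasFDerivAt_levelMap (S : Sg.cones) {p : M} (hp : p ∈ (X.chart S).source) :
    HasFDerivAt (K.levelMap S ζ c)
      ((ContinuousLinearMap.pi fun j => Complex.imCLM.comp
        (ContinuousLinearMap.proj (R := ℝ) (φ := fun _ : Fin m => ℂ) j)).prod
      (ContinuousLinearMap.pi fun i =>
        -(K.chartForm S p hp (X.fundCoord S (ζ i) (X.chart S p))).toContinuousLinearMap))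
      (X.chart S p) := by
  refine HasFDerivAt.prodMk ?_ ?_
  · exact hasFDerivAt_pi.2 fun j => Complex.imCLM.hasFDerivAt.comp _ (hasFDerivAt_apply j _)
  · exact hasFDerivAt_pi.2 fun i => (K.hasFDerivAt_mu_chart S hp (ζ i)).sub_const _

/-- Imaginary vectors account for the `Im w` components, so it suffices that the forms `ω((ζ_i)_p,
·)` are independent on real vectors. A relation among them gives `v ∈ V_ζ` with `ω(v_p, ·) = 0` on
real vectors, in particular on `-i v_p`, whence `v = 0`. -/
theorem ToricKahler.fderiv_levelMap_surjective (hζ : LinearIndependent ℝ ζ) {p : M}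
    (hreg : K.IsRegularPt ζ (K.mu p)) (S : Sg.cones) (hp : p ∈ (X.chart S).source)
    (hreal : ∀ j, (X.chart S p j).im = 0) :
    Function.Surjective (fderiv ℝ (K.levelMap S ζ c) (X.chart S p)) := by
  rw [(K.hasFDerivAt_levelMap S hp).fderiv]
  set B : Fin n → Cm m →ₗ[ℝ] ℝ := fun i => K.chartForm S p hp (X.fundCoord S (ζ i) (X.chart S p))
    with hB
  set R : (Fin m → ℝ) →ₗ[ℝ] (Fin n → ℝ) := (LinearMap.pi B).comp (realVec m) with hR
  have hRs : LinearMap.range R = ⊤ := by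
    by_contra hne
    obtain ⟨f, hf0, hf⟩ := Submodule.exists_le_ker_of_lt_top _ (lt_top_iff_ne_top.2 hne)
    set a : Fin n → ℝ := fun i => f (Pi.single i 1) with ha
    have hfa : ∀ t : Fin n → ℝ, f t = ∑ i, a i * t i := by
      intro t
      conv_lhs => rw [← Finset.univ_sum_single t]
      rw [map_sum]
      refine Finset.sum_congr rfl fun i _ => ?_
      have h1 : (Pi.single i (t i) : Fin n → ℝ) = t i • Pi.single i 1 := by
        rw [← Pi.single_smul, smul_eq_mul, mul_one]
      rw [h1, map_smul, smul_eq_mul, mul_comm]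
    set v : Lie m := ∑ i, a i • ζ i with hv
    have hvmem : v ∈ spanZeta ζ := Submodule.sum_mem _ fun i _ =>
      Submodule.smul_mem _ _ (Submodule.subset_span ⟨i, rfl⟩)
    have h1 : ∀ x, K.chartForm S p hp (X.fundCoord S v (X.chart S p)) (realVec m x) = 0 := by
      intro x
      have h2 : f (R x) = 0 := hf ⟨x, rfl⟩
      rw [hfa] at h2
      rw [← X.fundLin_apply, hv, map_sum, map_sum, LinearMap.sum_apply, ← h2]
      refine Finset.sum_congr rfl fun i _ => ?_
      rw [map_smul, map_smul, LinearMap.smul_apply, smul_eq_mul]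
      rfl
    have h3 : v = 0 := K.eq_zero_of_chartForm_realFund hreg S hp hreal hvmem (h1 _)
    have h4 := Fintype.linearIndependent_iff.1 hζ a (hv ▸ h3)
    refine hf0 (LinearMap.ext fun t => ?_)
    rw [hfa]
    simp [h4]
  rintro ⟨s, t⟩
  obtain ⟨x, hx⟩ := LinearMap.range_eq_top.1 hRs
    -- The real vector `x` compensates the contribution of the imaginary vector `i s`; the sign of
    -- `t` is that of `d⟨μ, v⟩ = -ω(v_p, ·)`.
    (fun i => -t i - B i (Complex.I • realVec m s))
  refine ⟨realVec m x + Complex.I • realVec m s, Prod.ext ?_ ?_⟩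
  · funext j
    change (realVec m x j + Complex.I * realVec m s j).im = s j
    simp [realVec_apply]
  · funext i
    have h1 : B i (realVec m x) = -t i - B i (Complex.I • realVec m s) := congrFun hx i
    change -(B i (realVec m x + Complex.I • realVec m s)) = t i
    rw [map_add, h1]
    ring

theorem ToricKahler.nonempty_embeddedSubmanifold [T2Space M] (hζ : LinearIndependent ℝ ζ)
    (hreg : ∀ y ∈ Set.range K.mu, (∀ i, pair y (ζ i) = c i) → K.IsRegularPt ζ y) :
    Nonempty (EmbeddedSubmanifold m (K.realLevel ζ c) (m - n)) := by
  have hnm : n ≤ m := by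
    have := hζ.fintype_card_le_finrank
    simpa using this
  refine nonempty_embeddedSubmanifold_of_regular (F := (Fin m → ℝ) × (Fin n → ℝ)) ?_ ?_
  · intro p hp
    obtain ⟨S, hpS⟩ := X.cover p
    refine ⟨X.chart S, X.chart_mem_real S, hpS, K.levelMap S ζ c, K.contDiffOn_levelMap S, ?_,
      K.fderiv_levelMap_surjective hζ (hreg _ ⟨p, rfl⟩ hp.2) S hpS
        ((X.mem_realForm_iff S hpS).1 hp.1)⟩
    intro q hq
    change (q ∈ X.realForm ∧ _) ↔ _
    rw [X.mem_realForm_iff S hq, ToricKahler.levelMap, Prod.mk_eq_zero, (X.chart S).left_inv hq,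
      funext_iff, funext_iff]
    simp [sub_eq_zero]
  · simp
    omega

end RealLevel

/-! ### Determinants and arguments -/

section Determinant

/-- Since `|h| e^{i(arg h - θ)} = r` is real, `sin (arg h - θ) = 0`; the sign of `r` is invisible
modulo `π`. -/
theorem coe_arg_eq_of_eq_mul_exp {h : ℂ} {r θ : ℝ} (hr : r ≠ 0)
    (hh : h = r * Complex.exp (θ * Complex.I)) :
    h ≠ 0 ∧ (Complex.arg h : AddCircle Real.pi) = (θ : AddCircle Real.pi) := by
  have hr' : (r : ℂ) ≠ 0 := by exact_mod_cast hr
  have h0 : h ≠ 0 := hh ▸ mul_ne_zero hr' (Complex.exp_ne_zero _)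
  refine ⟨h0, ?_⟩
  have h1 := Complex.norm_mul_exp_arg_mul_I h
  have h2 : (‖h‖ : ℂ) * Complex.exp (((Complex.arg h - θ : ℝ) : ℂ) * Complex.I) = r := by
    have h3 : ((Complex.arg h - θ : ℝ) : ℂ) * Complex.I
        = (Complex.arg h : ℂ) * Complex.I - θ * Complex.I := by
      push_cast
      ring
    rw [h3, Complex.exp_sub, ← mul_div_assoc, h1, hh, mul_div_assoc,
      div_self (Complex.exp_ne_zero _), mul_one]
  have h4 := congrArg Complex.im h2
  rw [Complex.im_ofReal_mul, Complex.exp_ofReal_mul_I_im, Complex.ofReal_im] at h4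
  have h5 := (mul_eq_zero.1 h4).resolve_left (norm_ne_zero_iff.2 h0)
  obtain ⟨k, hk⟩ := Real.sin_eq_zero_iff.1 h5
  rw [← sub_eq_zero, ← AddCircle.coe_sub, AddCircle.coe_eq_zero_iff]
  exact ⟨k, by simpa using hk⟩

/-- The determinant of a frame adapted to a splitting `ℂ^m ⊃ R ⊕ iR'` into real and imaginary
vectors. -/
theorem det_real_add_I_smul {m n : ℕ} {E V : Type*} [AddCommGroup E] [Module ℝ E]
    [AddCommGroup V] [Module ℝ V] [FiniteDimensional ℝ E] [FiniteDimensional ℝ V]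
    (hV : Module.finrank ℝ V = n) (hE : Module.finrank ℝ E + n = m)
    (ι : E →ₗ[ℝ] (Fin m → ℝ)) (κ : V →ₗ[ℝ] (Fin m → ℝ))
    (hinj : ∀ a b, ι a + κ b = 0 → a = 0 ∧ b = 0) (b : Module.Basis (Fin m) ℝ (E × V)) :
    ∃ r : ℝ, r ≠ 0 ∧ (Matrix.of fun i j => ((ι (b i).1 j : ℝ) : ℂ)
      + Complex.I * ((κ (b i).2 j : ℝ) : ℂ)).det = r * Complex.I ^ n := by
  set k := Module.finrank ℝ E with hk
  set b₁ := Module.finBasis ℝ E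
  set b₂ := Module.finBasisOfFinrankEq ℝ V hV
  set σ : Fin k ⊕ Fin n ≃ Fin m := finSumFinEquiv.trans (finCongr hE)
  -- In a basis adapted to `E × V`, the rows are those of the real matrix `R₀`, with a factor `i`
  -- exactly for the `n` vectors of `V`. The change of basis `P` is real.
  set b₀ := (b₁.prod b₂).reindex σ with hb₀
  set ε : Fin m → ℂ := fun l => Sum.elim (fun _ => 1) (fun _ => Complex.I) (σ.symm l) with hε
  set R : Matrix (Fin m) (Fin m) ℝ := Matrix.of fun i j => (ι (b i).1 + κ (b i).2) j with hR
  set R₀ : Matrix (Fin m) (Fin m) ℝ := Matrix.of fun i j => (ι (b₀ i).1 + κ (b₀ i).2) j with hR₀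
  set P : Matrix (Fin m) (Fin m) ℝ := Matrix.of fun i l => b₀.repr (b i) l with hP
  have hsum : ∀ i, b i = ∑ l, P i l • b₀ l := fun i => (b₀.sum_repr (b i)).symm
  have hPR : R = P * R₀ := by
    ext i j
    rw [Matrix.mul_apply, hR, Matrix.of_apply]
    conv_lhs => rw [hsum i]
    simp [hR₀, Prod.fst_sum, Prod.snd_sum, mul_add, Finset.sum_add_distrib]
  have hε₀ : ∀ l j, ((ι (b₀ l).1 j : ℝ) : ℂ) + Complex.I * ((κ (b₀ l).2 j : ℝ) : ℂ)
      = ε l * (R₀ l j : ℂ) := by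
    intro l j
    obtain ⟨s, rfl⟩ := σ.surjective l
    rcases s with s | s <;> simp [hε, hR₀, hb₀, b₁, b₂]
  have hC : (Matrix.of fun i j => ((ι (b i).1 j : ℝ) : ℂ) + Complex.I * ((κ (b i).2 j : ℝ) : ℂ))
      = P.map (algebraMap ℝ ℂ) * Matrix.of fun l j => ε l * (R₀.map (algebraMap ℝ ℂ)) l j := by
    ext i j
    rw [Matrix.mul_apply, Matrix.of_apply]
    conv_lhs => rw [hsum i]
    have : ∀ l, (P.map (algebraMap ℝ ℂ)) i l * (Matrix.of fun l j => ε l *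
        (R₀.map (algebraMap ℝ ℂ)) l j) l j = (P i l : ℂ) * (((ι (b₀ l).1 j : ℝ) : ℂ)
          + Complex.I * ((κ (b₀ l).2 j : ℝ) : ℂ)) := by
      intro l
      rw [hε₀]
      rfl
    rw [Finset.sum_congr rfl fun l _ => this l]
    simp [Prod.fst_sum, Prod.snd_sum, mul_add, Finset.sum_add_distrib, Finset.mul_sum]
    exact Finset.sum_congr rfl fun l _ => by ring
  have hprod : ∏ l, ε l = Complex.I ^ n := by
    rw [← σ.prod_comp]
    simp [hε]
  refine ⟨R.det, ?_, ?_⟩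
  -- The rows of `R` are the images of a basis under the injective real map `ι + κ`.
  · have h1 : LinearIndependent ℝ fun i => R i := by
      set L : E × V →ₗ[ℝ] (Fin m → ℝ) := ι.coprod κ
      have hL : LinearMap.ker L = ⊥ := by
        rw [LinearMap.ker_eq_bot']
        rintro ⟨a, c⟩ h
        obtain ⟨h1, h2⟩ := hinj a c h
        rw [h1, h2]
        rfl
      exact b.linearIndependent.map' L hL
    exact ((Matrix.isUnit_iff_isUnit_det _).1 (Matrix.linearIndependent_rows_iff_isUnit.1 h1)).ne_zero
  · rw [hC, Matrix.det_mul, Matrix.det_mul_column, hprod, hPR, Matrix.det_mul]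
    have h1 : ∀ A : Matrix (Fin m) (Fin m) ℝ, (A.map (algebraMap ℝ ℂ)).det = (A.det : ℂ) :=
      fun A => (RingHom.map_det (algebraMap ℝ ℂ) A).symm
    rw [h1, h1]
    push_cast
    ring

end Determinant

/-! ### The derivative of the immersions -/

section Immersion

theorem contDiff_expCoord {m : ℕ} {V : Type*} [NormedAddCommGroup V] [NormedSpace ℝ V]
    (l : Fin m → V →L[ℝ] ℝ) : ContDiff ℝ ∞ fun y : Cm m × V => fun j =>
      Complex.exp (2 * Real.pi * Complex.I * (l j y.2 : ℂ)) * y.1 j := by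
  refine contDiff_pi.2 fun j => ContDiff.mul (ContDiff.cexp (contDiff_const.mul ?_)) ?_
  · exact Complex.ofRealCLM.contDiff.comp ((l j).contDiff.comp contDiff_snd)
  · exact (contDiff_apply ℝ ℂ j).comp contDiff_fst

theorem exists_hasFDerivAt_expCoord {m : ℕ} {V : Type*} [NormedAddCommGroup V] [NormedSpace ℝ V]
    (l : Fin m → V →L[ℝ] ℝ) (x : Cm m × V) : ∃ A : Cm m × V →L[ℝ] Cm m,
      HasFDerivAt (fun y : Cm m × V => fun j =>
        Complex.exp (2 * Real.pi * Complex.I * (l j y.2 : ℂ)) * y.1 j) A x ∧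
      ∀ y j, A y j = Complex.exp (2 * Real.pi * Complex.I * (l j x.2 : ℂ)) *
        (y.1 j + 2 * Real.pi * Complex.I * (l j y.2 : ℂ) * x.1 j) := by
  have h : ∀ j, HasFDerivAt (fun y : Cm m × V =>
      Complex.exp (2 * Real.pi * Complex.I * (l j y.2 : ℂ)) * 1 * y.1 j) _ x := fun j =>
    ((hasFDerivAt_exp_mul (l j) 1 x.2).comp x hasFDerivAt_snd).mul
      ((hasFDerivAt_apply (𝕜 := ℝ) j x.1).comp x hasFDerivAt_fst)
  refine ⟨_, hasFDerivAt_pi.2 fun j => (h j).congr_of_eventuallyEq (by simp), fun y j => ?_⟩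
  simp
  ring

variable {m d n k : ℕ} {Sg : SmoothFan m d} {M : Type*} [TopologicalSpace M]
  [ChartedSpace (Cm m) M] [MulAction (CTorus m) M] {X : ToricManifold Sg M}
  (K : ToricKahler X) {ζ : Fin n → Lie m} {c : Fin n → ℝ}
  [ChartedSpace (EuclideanSpace ℝ (Fin k)) (K.realLevel ζ c)]

/-- The differential of the inclusion of the real level set in an affine toric chart. -/
def ToricKahler.levelDeriv (S : Sg.cones) (p : K.realLevel ζ c) :
    EuclideanSpace ℝ (Fin k) →L[ℝ] Cm m :=
  mfderiv (𝓡 k) 𝓘(ℝ, Cm m) (fun q : K.realLevel ζ c => X.chart S (q : M)) p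

variable (hval : ContMDiff (𝓡 k) 𝓘(ℝ, Cm m) ∞ (Subtype.val : K.realLevel ζ c → M))

include hval

theorem ToricKahler.contMDiffAt_chart_level (S : Sg.cones) {p : K.realLevel ζ c}
    (hp : (p : M) ∈ (X.chart S).source) :
    ContMDiffAt (𝓡 k) 𝓘(ℝ, Cm m) ∞ (fun q : K.realLevel ζ c => X.chart S (q : M)) p :=
  (contMDiffAt_of_mem_maximalAtlas (X.chart_mem_real S) hp).comp p hval.contMDiffAt

theorem ToricKahler.levelDeriv_injective (S : Sg.cones) {p : K.realLevel ζ c}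
    (hp : (p : M) ∈ (X.chart S).source)
    (hinj : Function.Injective (mfderiv (𝓡 k) 𝓘(ℝ, Cm m) (Subtype.val : K.realLevel ζ c → M) p)) :
    Function.Injective (K.levelDeriv (k := k) S p) := by
  intro Y Z h
  refine hinj ((mfderiv_chart_bijective (X.chart_mem_real S) hp).1 ?_)
  have h1 := mfderiv_chart_comp (X.chart_mem_real S) (I := 𝓡 k)
    (f := (Subtype.val : K.realLevel ζ c → M)) hp (hval.contMDiffAt.mdifferentiableAt (by simp))
  exact (h1 Y).trans (Eq.trans h (h1 Z).symm)

variable [T2Space M]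

/-- `levelMap` vanishes along the level set, so its differential kills the tangent vectors. -/
theorem ToricKahler.levelMap_levelDeriv (S : Sg.cones) {p : K.realLevel ζ c}
    (hp : (p : M) ∈ (X.chart S).source) (Y : EuclideanSpace ℝ (Fin k)) :
    (∀ j, (K.levelDeriv S p Y j).im = 0) ∧ ∀ i, K.chartForm S p hp
      (X.fundCoord S (ζ i) (X.chart S p)) (K.levelDeriv S p Y) = 0 := by
  have h1 := K.hasFDerivAt_levelMap (ζ := ζ) (c := c) S hp
  have h2 := (K.contMDiffAt_chart_level hval S hp).mdifferentiableAt (by simp)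
  have h3 := mfderiv_comp_apply p (g := K.levelMap S ζ c) (I'' := 𝓘(ℝ, (Fin m → ℝ) × (Fin n → ℝ)))
    h1.differentiableAt.mdifferentiableAt h2 Y
  have h4 : (K.levelMap S ζ c ∘ fun q : K.realLevel ζ c => X.chart S (q : M))
      =ᶠ[𝓝 p] fun _ => 0 := by
    filter_upwards [((X.chart S).open_source.preimage continuous_subtype_val).mem_nhds hp] with q hq
    have h5 := (X.mem_realForm_iff S hq).1 q.2.1
    simp only [Function.comp_apply, ToricKahler.levelMap]
    rw [(X.chart S).left_inv hq]
    refine Prod.ext (funext h5) (funext fun i => ?_)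
    simp [q.2.2 i]
  rw [h4.mfderiv_eq, mfderiv_const, mfderiv_eq_fderiv, h1.fderiv] at h3
  constructor
  · intro j
    exact (congrFun (congrArg Prod.fst h3) j).symm
  · intro i
    exact neg_eq_zero.1 (congrFun (congrArg Prod.snd h3) i).symm

theorem ToricKahler.chartForm_levelDeriv (S : Sg.cones) {p : K.realLevel ζ c}
    (hp : (p : M) ∈ (X.chart S).source) (Y : EuclideanSpace ℝ (Fin k)) {v : Lie m}
    (hv : v ∈ spanZeta ζ) :
    K.chartForm S p hp (X.fundCoord S v (X.chart S p)) (K.levelDeriv S p Y) = 0 := by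
  have h : spanZeta ζ ≤ LinearMap.ker (((K.chartForm S p hp).flip (K.levelDeriv S p Y)).comp
      (X.fundLin S (X.chart S p))) := by
    refine Submodule.span_le.2 ?_
    rintro _ ⟨i, rfl⟩
    exact (K.levelMap_levelDeriv hval S hp Y).2 i
  exact h hv

end Immersion

/-! ### The immersion in a toric chart: isotropy and injectivity of its differential -/

section Immersion

variable {m d n k : ℕ} {Sg : SmoothFan m d} {M : Type*} [TopologicalSpace M] [T2Space M]
  [ChartedSpace (Cm m) M] [MulAction (CTorus m) M] {X : ToricManifold Sg M}
  (K : ToricKahler X) {ζ : Fin n → Lie m} {c : Fin n → ℝ}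
  [ChartedSpace (EuclideanSpace ℝ (Fin k)) (K.realLevel ζ c)]
  {T : Type*} [TopologicalSpace T] [ChartedSpace (spanZeta ζ) T]

/-- The dual coordinates on `V_ζ`. -/
def spanCoord (ζ : Fin n → Lie m) (b : Module.Basis (Fin m) ℤ (Fin m → ℤ)) (j : Fin m) :
    spanZeta ζ →L[ℝ] ℝ :=
  ((dualCoord b j).comp (spanZeta ζ).subtype).toContinuousLinearMap

-- Only the local form `(p, t) ↦ exp(ψ(t)) · p` is used, with `ψ` a coordinate on the second factor;
-- ball and torus are both instances.
omit [T2Space M] [ChartedSpace (spanZeta ζ) T] in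
variable {K} in
theorem ToricKahler.exp_smul_chart_eventuallyEq {F : K.realLevel ζ c × T → M}
    {x : K.realLevel ζ c × T} {ψ : T → spanZeta ζ}
    (hF : F =ᶠ[𝓝 x] fun y => expT (ψ y.2 : Lie m) • (y.1 : M)) (S : Sg.cones)
    (hp : (x.1 : M) ∈ (X.chart S).source) :
    (∀ᶠ y in 𝓝 x, F y ∈ (X.chart S).source) ∧
    (fun y => X.chart S (F y)) =ᶠ[𝓝 x] fun y => fun j =>
      Complex.exp (2 * Real.pi * Complex.I * (spanCoord ζ (X.basis S) j (ψ y.2) : ℂ))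
        * X.chart S (y.1 : M) j := by
  have h1 : ∀ᶠ y in 𝓝 x, (y.1 : M) ∈ (X.chart S).source :=
    ((X.chart S).open_source.preimage (continuous_subtype_val.comp continuous_fst)).mem_nhds hp
  constructor
  · filter_upwards [hF, h1] with y hy hys
    rw [hy]
    exact X.smul_mem_source S _ _ hys
  · filter_upwards [hF, h1] with y hy hys
    rw [hy]
    funext j
    exact X.chart_expT_smul S hys _ j

variable (hval : ContMDiff (𝓡 k) 𝓘(ℝ, Cm m) ∞ (Subtype.val : K.realLevel ζ c → M))

include hval

variable {F : K.realLevel ζ c × T → M} {x : K.realLevel ζ c × T} {ψ : T → spanZeta ζ}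
    (hF : F =ᶠ[𝓝 x] fun y => expT (ψ y.2 : Lie m) • (y.1 : M))
    (hψ : ContMDiffAt 𝓘(ℝ, spanZeta ζ) 𝓘(ℝ, spanZeta ζ) ∞ ψ x.2)

include hF hψ

omit [T2Space M] in
theorem ToricKahler.contMDiffAt_of_eventuallyEq :
    ContMDiffAt ((𝓡 k).prod 𝓘(ℝ, spanZeta ζ)) 𝓘(ℝ, Cm m) ∞ F x := by
  obtain ⟨S, hp⟩ := X.cover (x.1 : M)
  obtain ⟨h1, h2⟩ := ToricKahler.exp_smul_chart_eventuallyEq hF S hp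
  refine contMDiffAt_of_chart_comp (X.chart_mem_real S) h1 ?_
  have h3 : ContMDiffAt ((𝓡 k).prod 𝓘(ℝ, spanZeta ζ)) 𝓘(ℝ, Cm m) ∞
      (fun y : K.realLevel ζ c × T => X.chart S (y.1 : M)) x :=
    ContMDiffAt.comp x (g := fun q : K.realLevel ζ c => X.chart S (q : M))
      (K.contMDiffAt_chart_level hval S hp) contMDiffAt_fst
  have h4 : ContMDiffAt ((𝓡 k).prod 𝓘(ℝ, spanZeta ζ)) 𝓘(ℝ, spanZeta ζ) ∞
      (fun y : K.realLevel ζ c × T => ψ y.2) x :=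
    ContMDiffAt.comp x (g := ψ) hψ contMDiffAt_snd
  have h5 : ContMDiffAt ((𝓡 k).prod 𝓘(ℝ, spanZeta ζ)) 𝓘(ℝ, Cm m × spanZeta ζ) ∞
      (fun y : K.realLevel ζ c × T => (X.chart S (y.1 : M), ψ y.2)) x := h3.prodMk_space h4
  have h6 := (contDiff_expCoord (spanCoord ζ (X.basis S))).contDiffAt.comp_contMDiffAt h5
  exact h6.congr_of_eventuallyEq h2

-- Up to the phases of `exp(ψ)`, the differential adds a tangent vector of the level set and a
-- fundamental vector of `V_ζ`.
omit [T2Space M] in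
theorem ToricKahler.chartDeriv_imm (S : Sg.cones) (hp : (x.1 : M) ∈ (X.chart S).source)
    (Y : EuclideanSpace ℝ (Fin k) × spanZeta ζ) (v : spanZeta ζ)
    (hv : v = mfderiv 𝓘(ℝ, spanZeta ζ) 𝓘(ℝ, spanZeta ζ) ψ x.2 Y.2) (j : Fin m) :
    chartDeriv (X.chart S) (F x)
      (mfderiv ((𝓡 k).prod 𝓘(ℝ, spanZeta ζ)) 𝓘(ℝ, Cm m) F x Y) j
      = Complex.exp (2 * Real.pi * Complex.I * (dualCoord (X.basis S) j (ψ x.2 : Lie m) : ℂ))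
        * (K.levelDeriv S x.1 Y.1 + X.fundCoord S (v : Lie m) (X.chart S x.1)) j := by
  have hd := (K.contMDiffAt_of_eventuallyEq hval hF hψ).mdifferentiableAt (by simp)
  obtain ⟨h1, h2⟩ := ToricKahler.exp_smul_chart_eventuallyEq hF S hp
  have h3 := mfderiv_chart_comp (X.chart_mem_real S) h1.self_of_nhds hd Y
  rw [h2.mfderiv_eq] at h3
  obtain ⟨A, hA, hA'⟩ := exists_hasFDerivAt_expCoord (spanCoord ζ (X.basis S))
    (X.chart S (x.1 : M), ψ x.2)
  have h4 : HasMFDerivAt ((𝓡 k).prod 𝓘(ℝ, spanZeta ζ)) 𝓘(ℝ, Cm m)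
      (fun y : K.realLevel ζ c × T => X.chart S (y.1 : M)) x _ :=
    HasMFDerivAt.comp x (g := fun q : K.realLevel ζ c => X.chart S (q : M))
      ((K.contMDiffAt_chart_level hval S hp).mdifferentiableAt (by simp)).hasMFDerivAt
      (hasMFDerivAt_fst x)
  have h5 : HasMFDerivAt ((𝓡 k).prod 𝓘(ℝ, spanZeta ζ)) 𝓘(ℝ, spanZeta ζ)
      (fun y : K.realLevel ζ c × T => ψ y.2) x _ :=
    HasMFDerivAt.comp x (g := ψ) (hψ.mdifferentiableAt (by simp)).hasMFDerivAt
      (hasMFDerivAt_snd x)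
  have h6 : HasMFDerivAt ((𝓡 k).prod 𝓘(ℝ, spanZeta ζ)) 𝓘(ℝ, Cm m × spanZeta ζ)
      (fun y : K.realLevel ζ c × T => (X.chart S (y.1 : M), ψ y.2)) x _ :=
    ⟨h4.1.prodMk h5.1, HasFDerivWithinAt.prodMk h4.2 h5.2⟩
  have h7 := HasMFDerivAt.comp x hA.hasMFDerivAt h6
  have h8 := h3.trans (congrArg (fun B : EuclideanSpace ℝ (Fin k) × spanZeta ζ →L[ℝ] Cm m => B Y)
    h7.mfderiv)
  refine (congrFun h8 j).trans ((hA' _ j).trans ?_)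
  subst hv
  rfl

variable
  (hψd : Function.Bijective (mfderiv 𝓘(ℝ, spanZeta ζ) 𝓘(ℝ, spanZeta ζ) ψ x.2))
  (hinj : Function.Injective (mfderiv (𝓡 k) 𝓘(ℝ, Cm m) (Subtype.val : K.realLevel ζ c → M) x.1))
  (hreg : K.IsRegularPt ζ (K.mu x.1))

/-- Invariance of the form removes the phases. The remaining pairings are orbit with orbit, orbit
with level set, and real with real, and each vanishes. -/
theorem ToricKahler.form_imm_eq_zero (Y Z : EuclideanSpace ℝ (Fin k) × spanZeta ζ) :
    K.form (F x) ![mfderiv ((𝓡 k).prod 𝓘(ℝ, spanZeta ζ)) 𝓘(ℝ, Cm m) F x Y,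
      mfderiv ((𝓡 k).prod 𝓘(ℝ, spanZeta ζ)) 𝓘(ℝ, Cm m) F x Z] = 0 := by
  obtain ⟨S, hp⟩ := X.cover (x.1 : M)
  have hFs := (ToricKahler.exp_smul_chart_eventuallyEq hF S hp).1.self_of_nhds
  rw [← K.chartForm_chartDeriv S hFs,
    funext (K.chartDeriv_imm hval hF hψ S hp Y _ rfl),
    funext (K.chartDeriv_imm hval hF hψ S hp Z _ rfl),
    K.chartForm_expT S hp hFs _ hF.self_of_nhds]
  set u : spanZeta ζ := mfderiv 𝓘(ℝ, spanZeta ζ) 𝓘(ℝ, spanZeta ζ) ψ x.2 Y.2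
  set v : spanZeta ζ := mfderiv 𝓘(ℝ, spanZeta ζ) 𝓘(ℝ, spanZeta ζ) ψ x.2 Z.2
  rw [map_add, map_add, LinearMap.add_apply, LinearMap.add_apply, K.chartForm_fundCoord,
    K.chartForm_levelDeriv hval S hp _ u.2, K.chartForm_swap S hp (K.levelDeriv S x.1 Y.1)
      (X.fundCoord S v _), K.chartForm_levelDeriv hval S hp _ v.2,
    K.chartForm_real S hp ((X.mem_realForm_iff S hp).1 x.1.2.1)
      (K.levelMap_levelDeriv hval S hp _).1 (K.levelMap_levelDeriv hval S hp _).1]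
  simp

-- Tangent vectors of the level set are `ω`-orthogonal to every `v_p` with `v ∈ V_ζ`. If such a
-- vector equals `i v_p` for the same `v`, positivity forces both to vanish. Stated inside the real
-- vectors, this gives both injectivity of the differential and a nonzero determinant.
omit hF hψ in
theorem ToricKahler.levelDeriv_add_realFund_eq_zero {p : K.realLevel ζ c}
    (hinj : Function.Injective (mfderiv (𝓡 k) 𝓘(ℝ, Cm m) (Subtype.val : K.realLevel ζ c → M) p))
    (hreg : K.IsRegularPt ζ (K.mu p)) (S : Sg.cones) (hp : (p : M) ∈ (X.chart S).source)
    (Y : EuclideanSpace ℝ (Fin k)) (v : spanZeta ζ)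
    (h : K.levelDeriv S p Y + realVec m (X.realFund S (X.chart S p) (v : Lie m)) = 0) :
    Y = 0 ∧ v = 0 := by
  have h1 := K.chartForm_levelDeriv hval S hp Y v.2
  rw [eq_neg_of_add_eq_zero_left h, map_neg, neg_eq_zero] at h1
  have h2 := K.eq_zero_of_chartForm_realFund hreg S hp ((X.mem_realForm_iff S hp).1 p.2.1) v.2 h1
  rw [h2, map_zero, map_zero, add_zero] at h
  exact ⟨K.levelDeriv_injective hval S hp hinj (h.trans (map_zero _).symm), Subtype.ext h2⟩

include hψd hinj hreg

theorem ToricKahler.injective_mfderiv_imm : Function.Injective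
    (mfderiv ((𝓡 k).prod 𝓘(ℝ, spanZeta ζ)) 𝓘(ℝ, Cm m) F x) := by
  rw [injective_iff_map_eq_zero]
  intro Y hY
  obtain ⟨S, hp⟩ := X.cover (x.1 : M)
  have hreal := (X.mem_realForm_iff S hp).1 x.1.2.1
  set v : spanZeta ζ := mfderiv 𝓘(ℝ, spanZeta ζ) 𝓘(ℝ, spanZeta ζ) ψ x.2 Y.2 with hv
  have h1 : K.levelDeriv S x.1 Y.1 + X.fundCoord S (v : Lie m) (X.chart S x.1) = 0 := by
    funext j
    have h2 := K.chartDeriv_imm hval hF hψ S hp Y v hv j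
    rw [hY, map_zero] at h2
    exact (mul_eq_zero.1 h2.symm).resolve_left (Complex.exp_ne_zero _)
  rw [X.fundCoord_eq_I_smul S hreal] at h1
  -- The level vector is real and the fundamental vector imaginary, so they vanish separately.
  have h3 : ∀ j, K.levelDeriv S x.1 Y.1 j = 0 ∧ X.realFund S (X.chart S x.1) (v : Lie m) j = 0 := by
    intro j
    have h4 : K.levelDeriv S x.1 Y.1 j
      + Complex.I * (X.realFund S (X.chart S x.1) (v : Lie m) j : ℂ) = 0 := congrFun h1 j
    have h5 := (K.levelMap_levelDeriv hval S hp Y.1).1 j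
    have h6 := congrArg Complex.re h4
    have h7 := congrArg Complex.im h4
    simp [h5] at h6 h7
    exact ⟨Complex.ext h6 h5, h7⟩
  have h8 : K.levelDeriv S x.1 Y.1 = 0 := funext fun j => (h3 j).1
  have h9 : X.realFund S (X.chart S x.1) (v : Lie m) = 0 := funext fun j => (h3 j).2
  obtain ⟨h10, h11⟩ := K.levelDeriv_add_realFund_eq_zero hval hinj hreg S hp Y.1 v
    (by rw [h8, h9, map_zero, add_zero])
  refine Prod.ext h10 (hψd.1 ?_)
  rw [← hv, h11]
  exact (map_zero _).symm

end Immersion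

/-! ### The Lagrangian angle -/

theorem det_basis_ne_zero {m : ℕ} (b : Module.Basis (Fin m) ℤ (Fin m → ℤ)) :
    (Matrix.of fun j k => b j k).det ≠ 0 := by
  have h : (Matrix.of fun k j => b.repr (Pi.single k 1) j) * (Matrix.of fun j k => b j k) = 1 := by
    ext k l
    rw [Matrix.mul_apply, Matrix.one_apply]
    simp only [Matrix.of_apply]
    rw [sum_repr_mul_basis, Pi.single_apply]
    simp [eq_comm]
  intro h0
  have h1 := congrArg Matrix.det h
  rw [Matrix.det_mul, h0, mul_zero, Matrix.det_one] at h1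
  exact zero_ne_one h1

section Angle

variable {m d n k : ℕ} {Sg : SmoothFan m d} {M : Type*} [TopologicalSpace M] [T2Space M]
  [ChartedSpace (Cm m) M] [MulAction (CTorus m) M] {X : ToricManifold Sg M}
  (K : ToricKahler X) {ζ : Fin n → Lie m} {c : Fin n → ℝ}
  [ChartedSpace (EuclideanSpace ℝ (Fin k)) (K.realLevel ζ c)]
  {T : Type*} [TopologicalSpace T] [ChartedSpace (spanZeta ζ) T]

theorem finrank_spanZeta (hζ : LinearIndependent ℝ ζ) :
    Module.finrank ℝ (spanZeta ζ) = n :=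
  (finrank_span_eq_card hζ).trans (Fintype.card_fin n)

omit [T2Space M] in
/-- The weight of `Ω_γ` in an affine toric chart, at a point of the `T^m`-orbit of a real point. -/
theorem ToricManifold.exists_prod_zpow_eq (X : ToricManifold Sg M) {γ : Fin m → ℤ}
    (hγ : ∀ i, ∑ k, γ k * Sg.ray i k = 1) (S : Sg.cones) {p : M} (hp : p ∈ (X.chart S).source)
    (hreal : ∀ j, (X.chart S p j).im = 0) (v : Lie m) :
    ∃ r : ℝ, r ≠ 0 ∧ (∏ j, (X.chart S (expT v • p) j) ^ ((∑ k, γ k * X.basis S j k) - 1))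
      * ∏ j, Complex.exp (2 * Real.pi * Complex.I * (dualCoord (X.basis S) j v : ℂ))
      = r * Complex.exp ((2 * Real.pi * pair (intVec γ) v : ℝ) * Complex.I) := by
  set N : Fin m → ℤ := fun j => ∑ k, γ k * X.basis S j k with hN
  set E : Fin m → ℂ := fun j =>
    Complex.exp (2 * Real.pi * Complex.I * (dualCoord (X.basis S) j v : ℂ)) with hE
  refine ⟨∏ j, (X.chart S p j).re ^ (N j - 1), ?_, ?_⟩
  · refine Finset.prod_ne_zero_iff.2 fun j _ => ?_
    by_cases hj : X.chart S p j = 0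
    · obtain ⟨i, hi⟩ := X.exists_ray_of_eq_zero S hp hj
      -- Where `w_j` vanishes, `b_j` is a ray, so its weight is `⟨γ, λ_i⟩ = 1` and the exponent `N j
      -- - 1` is zero.
      have h1 : N j = 1 := by
        simp only [hN]
        rw [← hi, X.basis_idx]
        exact hγ i
      rw [h1, sub_self, zpow_zero]
      exact one_ne_zero
    · refine zpow_ne_zero _ fun h0 => hj (Complex.ext h0 (hreal j))
  · have h1 : Complex.exp ((2 * Real.pi * pair (intVec γ) v : ℝ) * Complex.I) = ∏ j, E j ^ N j := by
      simp only [hE, ← Complex.exp_int_mul, ← Complex.exp_sum]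
      congr 1
      rw [pair_intVec_eq_sum (X.basis S)]
      push_cast
      rw [Finset.mul_sum, Finset.sum_mul]
      refine Finset.sum_congr rfl fun j _ => ?_
      simp only [hN]
      push_cast
      ring
    rw [h1]
    push_cast
    rw [← Finset.prod_mul_distrib, ← Finset.prod_mul_distrib]
    refine Finset.prod_congr rfl fun j _ => ?_
    have h2 : ((X.chart S p j).re : ℂ) = X.chart S p j :=
      Complex.ext (by simp) (by simp [hreal j])
    rw [X.chart_expT_smul S hp, h2, mul_zpow]
    -- `Ω_γ` contributes `N j - 1` phases of the `j`-th coordinate and the frame one more.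
    have h3 : E j ^ N j = E j ^ (N j - 1) * E j := by
      rw [← zpow_add_one₀ (Complex.exp_ne_zero _), sub_add_cancel]
    rw [h3]
    ring

/-- `F^*Ω_γ` on a frame is the product of an integer determinant, the weight of `Ω_γ`, the phases of
the differential and the determinant of a real-plus-imaginary frame. Its argument is that of `i^n
e^{2πi⟨γ, ψ⟩}`, up to a real factor. -/
theorem ToricKahler.hasLagrangianAngle
    (hval : ContMDiff (𝓡 k) 𝓘(ℝ, Cm m) ∞ (Subtype.val : K.realLevel ζ c → M))
    {F : K.realLevel ζ c × T → M} {x : K.realLevel ζ c × T} {ψ : T → spanZeta ζ}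
    (hF : F =ᶠ[𝓝 x] fun y => expT (ψ y.2 : Lie m) • (y.1 : M))
    (hψ : ContMDiffAt 𝓘(ℝ, spanZeta ζ) 𝓘(ℝ, spanZeta ζ) ∞ ψ x.2)
    (hψd : Function.Bijective (mfderiv 𝓘(ℝ, spanZeta ζ) 𝓘(ℝ, spanZeta ζ) ψ x.2))
    (hinj : Function.Injective
      (mfderiv (𝓡 k) 𝓘(ℝ, Cm m) (Subtype.val : K.realLevel ζ c → M) x.1))
    (hreg : K.IsRegularPt ζ (K.mu x.1)) (hζ : LinearIndependent ℝ ζ) (hk : k + n = m)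
    {γ : Fin m → ℤ} (hγ : ∀ i, ∑ k, γ k * Sg.ray i k = 1) :
    HasLagrangianAngle ((𝓡 k).prod 𝓘(ℝ, spanZeta ζ)) (X.volumeForm γ) F x
      ((n * (Real.pi / 2) + 2 * Real.pi * pair (intVec γ) (ψ x.2 : Lie m) : ℝ) :
        AddCircle Real.pi) := by
  intro b
  set b' : Module.Basis (Fin m) ℝ (EuclideanSpace ℝ (Fin k) × spanZeta ζ) := b with hb'
  set S := X.coneAt (F x) with hS
  have hFx : F x = expT (ψ x.2 : Lie m) • (x.1 : M) := hF.self_of_nhds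
  have hFs : F x ∈ (X.chart S).source := X.mem_source_coneAt _
  -- `volumeForm` uses the chart selected at `F x`; moving back by `exp(-ψ)` shows that it contains
  -- the real point too.
  have hp : (x.1 : M) ∈ (X.chart S).source := by
    have h1 := X.smul_mem_source S (expT (-(ψ x.2 : Lie m))) _ hFs
    rwa [hFx, ← mul_smul, ← expT_add, neg_add_cancel, expT_zero, one_smul] at h1
  have hreal := (X.mem_realForm_iff S hp).1 x.1.2.1
  set A : spanZeta ζ →L[ℝ] spanZeta ζ := mfderiv 𝓘(ℝ, spanZeta ζ) 𝓘(ℝ, spanZeta ζ) ψ x.2 with hA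
  set ι : EuclideanSpace ℝ (Fin k) →ₗ[ℝ] (Fin m → ℝ) :=
    (Complex.reLm.compLeft (Fin m)).comp (K.levelDeriv S x.1).toLinearMap with hι
  set κ : spanZeta ζ →ₗ[ℝ] (Fin m → ℝ) :=
    ((X.realFund S (X.chart S x.1)).comp (spanZeta ζ).subtype).comp A.toLinearMap with hκ
  have hιr : ∀ Y, realVec m (ι Y) = K.levelDeriv S x.1 Y := fun Y => funext fun j =>
    Complex.ext rfl ((K.levelMap_levelDeriv hval S hp Y).1 j).symm
  have hικ : ∀ Y v, ι Y + κ v = 0 → Y = 0 ∧ v = 0 := by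
    intro Y v h
    have h1 := congrArg (realVec m) h
    rw [map_add, hιr, map_zero] at h1
    obtain ⟨h2, h3⟩ := K.levelDeriv_add_realFund_eq_zero hval hinj hreg S hp Y (A v) h1
    exact ⟨h2, hψd.1 (h3.trans (map_zero A).symm)⟩
  obtain ⟨r₂, hr₂, hdet⟩ := det_real_add_I_smul (finrank_spanZeta hζ)
    (by rw [finrank_euclideanSpace_fin, hk]) ι κ hικ b'
  obtain ⟨r₁, hr₁, hprod⟩ := X.exists_prod_zpow_eq hγ S hp hreal (ψ x.2 : Lie m)
  have hM : (Matrix.of fun i j => chartDeriv (X.chart S) (F x)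
      (mfderiv ((𝓡 k).prod 𝓘(ℝ, spanZeta ζ)) 𝓘(ℝ, Cm m) F x (b i)) j)
      = Matrix.of fun i j => Complex.exp (2 * Real.pi * Complex.I *
          (dualCoord (X.basis S) j (ψ x.2 : Lie m) : ℂ)) *
        (Matrix.of fun i j => ((ι (b' i).1 j : ℝ) : ℂ)
          + Complex.I * ((κ (b' i).2 j : ℝ) : ℂ)) i j := by
    ext i j
    refine (K.chartDeriv_imm hval hF hψ S hp (b' i) (A (b' i).2) rfl j).trans ?_
    rw [← hιr, X.fundCoord_eq_I_smul S hreal]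
    rfl
  obtain ⟨D, hD⟩ : ∃ D, D = (Matrix.of fun j k => X.basis S j k).det := ⟨_, rfl⟩
  have hD0 : D ≠ 0 := hD ▸ det_basis_ne_zero (X.basis S)
  refine coe_arg_eq_of_eq_mul_exp (r := (D : ℝ) * r₁ * r₂) ?_ ?_
  · exact mul_ne_zero (mul_ne_zero (Int.cast_ne_zero.2 hD0) hr₁) hr₂
  · have h1 : X.volumeForm γ (F x)
        (fun j => mfderiv ((𝓡 k).prod 𝓘(ℝ, spanZeta ζ)) 𝓘(ℝ, Cm m) F x (b j))
        = ((Matrix.of fun j k => X.basis S j k).det : ℂ)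
          * (∏ j, (X.chart S (F x) j) ^ ((∑ k, γ k * X.basis S j k) - 1))
          * (Matrix.of fun i j => chartDeriv (X.chart S) (F x)
            (mfderiv ((𝓡 k).prod 𝓘(ℝ, spanZeta ζ)) 𝓘(ℝ, Cm m) F x (b i)) j).det := rfl
    have h2 : Complex.I ^ n = Complex.exp ((n * (Real.pi / 2) : ℝ) * Complex.I) := by
      have h3 : Complex.exp ((Real.pi / 2 : ℂ) * Complex.I) = Complex.I := Complex.exp_pi_div_two_mul_I
      rw [← h3, ← Complex.exp_nat_mul, h3]
      congr 1
      push_cast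
      ring
    rw [h1, ← hD, hM, Matrix.det_mul_row, hdet, hFx, Complex.ofReal_add, add_mul, Complex.exp_add, ← h2]
    push_cast
    push_cast at hprod
    linear_combination (D : ℂ) * r₂ * Complex.I ^ n * hprod

-- The angle condition ranges over all frames, so it determines the angle once a frame exists; the
-- dimension hypothesis provides one.
omit [T2Space M] [MulAction (CTorus m) M] in
theorem HasLagrangianAngle.unique {E : Type*} [NormedAddCommGroup E] [NormedSpace ℝ E]
    [FiniteDimensional ℝ E] (hE : Module.finrank ℝ E = m) {H : Type*} [TopologicalSpace H]
    {I : ModelWithCorners ℝ E H} {L : Type*} [TopologicalSpace L] [ChartedSpace H L]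
    {Om : (p : M) → (Fin m → TangentSpace 𝓘(ℝ, Cm m) p) → ℂ} {F : L → M} {x : L}
    {θ θ' : AddCircle Real.pi} (h : HasLagrangianAngle I Om F x θ)
    (h' : HasLagrangianAngle I Om F x θ') : θ = θ' := by
  have b : Module.Basis (Fin m) ℝ E := Module.finBasisOfFinrankEq ℝ E hE
  exact (h b).2.symm.trans (h' b).2

/-- For small `t ≠ 0` the number `t a` is a multiple of `π` of absolute value less than `π`, hence
`0`. -/
theorem eq_zero_of_eventually_coe_eq {a : ℝ} (h : ∀ᶠ t : ℝ in 𝓝 0,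
    ((t * a : ℝ) : AddCircle Real.pi) = 0) : a = 0 := by
  by_contra ha
  have h1 : ∀ᶠ t : ℝ in 𝓝 0, |t * a| < Real.pi := by
    have h2 : Filter.Tendsto (fun t : ℝ => |t * a|) (𝓝 0) (𝓝 0) := by
      have : Continuous fun t : ℝ => |t * a| := by fun_prop
      simpa using this.tendsto 0
    exact h2.eventually (gt_mem_nhds Real.pi_pos)
  obtain ⟨t, ⟨ht1, ht2⟩, ht0⟩ := (((h.and h1).filter_mono nhdsWithin_le_nhds).and
    (self_mem_nhdsWithin (s := {(0 : ℝ)}ᶜ))).exists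
  obtain ⟨l, hl⟩ := (AddCircle.coe_eq_zero_iff _).1 ht1
  have hl0 : l = 0 := by
    rw [← hl, zsmul_eq_mul, abs_mul, abs_of_pos Real.pi_pos] at ht2
    have h3 : |(l : ℝ)| < 1 := by
      by_contra! h4
      nlinarith [Real.pi_pos]
    have h4 : |l| < 1 := by exact_mod_cast h3
    exact Int.abs_lt_one_iff.1 h4
  rw [hl0, zero_smul] at hl
  exact mul_ne_zero ht0 ha hl.symm

/-- The immersions that are locally of the form `(p, t) ↦ exp(ψ(t)) · p` for the charts `ψ` of
the second factor are Lagrangian, and they are special Lagrangian if and only if `γ` annihilates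
`V_ζ`. -/
theorem ToricKahler.isLagrangianImmersion_and_iff [IsManifold 𝓘(ℝ, spanZeta ζ) ∞ T] [Nonempty T]
    (hval : ContMDiff (𝓡 k) 𝓘(ℝ, Cm m) ∞ (Subtype.val : K.realLevel ζ c → M))
    (hinj : ∀ p, Function.Injective
      (mfderiv (𝓡 k) 𝓘(ℝ, Cm m) (Subtype.val : K.realLevel ζ c → M) p))
    (hne : (K.realLevel ζ c).Nonempty)
    (hreg : ∀ y ∈ Set.range K.mu, (∀ i, pair y (ζ i) = c i) → K.IsRegularPt ζ y)
    (hζ : LinearIndependent ℝ ζ) (hk : k + n = m)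
    {γ : Fin m → ℤ} (hγ : ∀ i, ∑ k, γ k * Sg.ray i k = 1)
    {F : K.realLevel ζ c × T → M}
    (hF : ∀ x : K.realLevel ζ c × T, F =ᶠ[𝓝 x] fun y =>
      expT (chartAt (spanZeta ζ) x.2 y.2 : Lie m) • (y.1 : M)) :
    IsLagrangianImmersion ((𝓡 k).prod 𝓘(ℝ, spanZeta ζ)) K.form F ∧
      (IsSpecialLagrangian ((𝓡 k).prod 𝓘(ℝ, spanZeta ζ)) K.form (X.volumeForm γ) F ↔
        ∀ i, pair (intVec γ) (ζ i) = 0) := by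
  have hfin : Module.finrank ℝ (EuclideanSpace ℝ (Fin k) × spanZeta ζ) = m := by
    rw [Module.finrank_prod, finrank_euclideanSpace_fin, finrank_spanZeta hζ, hk]
  have hreg' : ∀ p : K.realLevel ζ c, K.IsRegularPt ζ (K.mu p) := fun p =>
    hreg _ ⟨p, rfl⟩ p.2.2
  have hψ : ∀ t₀ t : T, t ∈ (chartAt (spanZeta ζ) t₀).source →
      ContMDiffAt 𝓘(ℝ, spanZeta ζ) 𝓘(ℝ, spanZeta ζ) ∞ (chartAt (spanZeta ζ) t₀) t := fun t₀ t ht =>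
    contMDiffAt_of_mem_maximalAtlas (IsManifold.chart_mem_maximalAtlas t₀) ht
  have hψd : ∀ t₀ t : T, t ∈ (chartAt (spanZeta ζ) t₀).source → Function.Bijective
      (mfderiv 𝓘(ℝ, spanZeta ζ) 𝓘(ℝ, spanZeta ζ) (chartAt (spanZeta ζ) t₀) t) := by
    intro t₀ t ht
    have : IsManifold 𝓘(ℝ, spanZeta ζ) 1 T := .of_le (n := ∞) (by simp)
    exact OpenPartialHomeomorph.MDifferentiable.mfderiv_bijective
      (mdifferentiable_of_mem_atlas (I := 𝓘(ℝ, spanZeta ζ)) (chart_mem_atlas _ t₀)) ht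
  have hL : IsLagrangianImmersion ((𝓡 k).prod 𝓘(ℝ, spanZeta ζ)) K.form F :=
    { finrank_eq := hfin
      smooth := fun x => K.contMDiffAt_of_eventuallyEq hval (hF x)
        (hψ _ _ (mem_chart_source _ x.2))
      injective_mfderiv := fun x => K.injective_mfderiv_imm hval (hF x)
        (hψ _ _ (mem_chart_source _ x.2)) (hψd _ _ (mem_chart_source _ x.2)) (hinj x.1)
        (hreg' x.1)
      pullback_eq_zero := fun x Y Z => K.form_imm_eq_zero hval (hF x)
        (hψ _ _ (mem_chart_source _ x.2)) Y Z }
  refine ⟨hL, fun h i => ?_, fun h => ⟨hL, n * (Real.pi / 2), fun x => ?_⟩⟩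
  · obtain ⟨-, θ₀, hθ⟩ := h
    obtain ⟨p, hp⟩ := hne
    obtain ⟨t₀⟩ := ‹Nonempty T›
    set ψ := chartAt (spanZeta ζ) t₀ with hψ₀
    set v : spanZeta ζ := ⟨ζ i, Submodule.subset_span ⟨i, rfl⟩⟩ with hv
    -- Along this curve in the direction `ζ_i` the angle varies as `2π s ⟨γ, ζ_i⟩` modulo `π`.
    set τ : ℝ → T := fun s => ψ.symm (ψ t₀ + s • v) with hτ
    have ht₀ : t₀ ∈ ψ.source := mem_chart_source _ t₀
    have hcont : ContinuousAt (fun s : ℝ => ψ t₀ + s • v) 0 := by fun_prop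
    have h0 : ψ t₀ + (0 : ℝ) • v = ψ t₀ := by simp
    have htgt : ∀ᶠ s in 𝓝 (0 : ℝ), ψ t₀ + s • v ∈ ψ.target :=
      hcont.eventually_mem (ψ.open_target.mem_nhds (by rw [h0]; exact ψ.map_source ht₀))
    have hτc : ContinuousAt (fun s => ((⟨p, hp⟩, τ s) : K.realLevel ζ c × T)) 0 := by
      refine continuousAt_const.prodMk ?_
      refine ContinuousAt.comp (g := ψ.symm) (f := fun s : ℝ => ψ t₀ + s • v) ?_ hcont
      rw [h0]
      exact ψ.continuousAt_symm (ψ.map_source ht₀)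
    have hτ0 : τ 0 = t₀ := by simp [hτ, ψ.left_inv ht₀]
    -- All points of the curve must be read in the one chart `ψ` at `t₀`, which is possible because
    -- an equality of germs persists at nearby points.
    have hev : ∀ᶠ s in 𝓝 (0 : ℝ), F =ᶠ[𝓝 ((⟨p, hp⟩, τ s) : K.realLevel ζ c × T)] fun y =>
        expT (ψ y.2 : Lie m) • (y.1 : M) := by
      have h1 : ∀ᶠ x in 𝓝 ((⟨p, hp⟩, t₀) : K.realLevel ζ c × T), F =ᶠ[𝓝 x] fun y =>
        expT (ψ y.2 : Lie m) • (y.1 : M) := (hF (⟨p, hp⟩, t₀)).eventuallyEq_nhds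
      rw [ContinuousAt, hτ0] at hτc
      exact hτc.eventually h1
    set a := pair (intVec γ) (ζ i) with ha
    have hangle : ∀ᶠ s in 𝓝 (0 : ℝ), ((n * (Real.pi / 2) + 2 * Real.pi *
        pair (intVec γ) (ψ t₀ : Lie m) + s * (2 * Real.pi * a) : ℝ) : AddCircle Real.pi) = θ₀ := by
      filter_upwards [htgt, hev] with s hs hFs
      have hτs : τ s ∈ ψ.source := ψ.map_target hs
      have h1 := K.hasLagrangianAngle hval hFs (hψ _ _ hτs) (hψd _ _ hτs) (hinj _) (hreg' _)
        hζ hk hγ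
      have h2 := HasLagrangianAngle.unique hfin h1 (hθ _)
      rw [← h2]
      congr 1
      have h3 : ψ (τ s) = ψ t₀ + s • v := ψ.right_inv hs
      simp only [h3]
      rw [Submodule.coe_add, Submodule.coe_smul, pair_add_right, pair_smul_right]
      ring
    have h1 := hangle.self_of_nhds
    rw [zero_mul, add_zero] at h1
    have h2 : 2 * Real.pi * a = 0 := by
      refine eq_zero_of_eventually_coe_eq ?_
      filter_upwards [hangle] with s hs
      rw [AddCircle.coe_add, h1] at hs
      simpa using hs
    have hpi := Real.pi_pos.ne'
    simpa [hpi] using h2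
  · have h1 := K.hasLagrangianAngle hval (hF x) (hψ _ _ (mem_chart_source _ x.2))
      (hψd _ _ (mem_chart_source _ x.2)) (hinj x.1) (hreg' x.1) hζ hk hγ
    have h2 : spanZeta ζ ≤ LinearMap.ker (pairLin (intVec γ)) := by
      refine Submodule.span_le.2 ?_
      rintro _ ⟨i, rfl⟩
      exact h i
    have h3 : pair (intVec γ) (chartAt (spanZeta ζ) x.2 x.2 : Lie m) = 0 :=
      h2 (chartAt (spanZeta ζ) x.2 x.2).2
    rwa [h3, mul_zero, add_zero] at h1

omit [T2Space M] in
theorem ToricKahler.immBall_eventuallyEq {r : ℝ} (x : K.realLevel ζ c × ballZeta ζ r) :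
    K.immBall ζ c r =ᶠ[𝓝 x] fun y =>
      expT (chartAt (spanZeta ζ) x.2 y.2 : Lie m) • (y.1 : M) :=
  Filter.Eventually.of_forall fun _ => rfl

-- A chart of `T_ζ` is a local section of `V_ζ → T_ζ`, so its value is a representative at which
-- `immTorus` can be evaluated.
omit [T2Space M] in
theorem ToricKahler.immTorus_eventuallyEq (x : K.realLevel ζ c × TorusZeta ζ) :
    K.immTorus ζ c =ᶠ[𝓝 x] fun y =>
      expT (chartAt (spanZeta ζ) x.2 y.2 : Lie m) • (y.1 : M) := by
  obtain ⟨v, hv⟩ : ∃ v, chartAt (spanZeta ζ) x.2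
      = (isLocalHomeomorph_torusZeta ζ).localInverseAt v := ⟨_, OpenPartialHomeomorph.trans_refl _⟩
  have h1 : ∀ᶠ y in 𝓝 x, y.2 ∈ (chartAt (spanZeta ζ) x.2).source :=
    ((chartAt (spanZeta ζ) x.2).open_source.preimage continuous_snd).mem_nhds
      (show x.2 ∈ _ from mem_chart_source (spanZeta ζ) x.2)
  filter_upwards [h1] with y hy
  have h2 : (QuotientAddGroup.mk (chartAt (spanZeta ζ) x.2 y.2) : TorusZeta ζ) = y.2 := by
    rw [hv] at hy ⊢
    exact (isLocalHomeomorph_torusZeta ζ).apply_localInverseAt_of_mem hy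
  have h3 : K.immTorus ζ c (y.1, QuotientAddGroup.mk (chartAt (spanZeta ζ) x.2 y.2))
      = expT (chartAt (spanZeta ζ) x.2 y.2 : Lie m) • (y.1 : M) := rfl
  rw [h2] at h3
  exact h3

end Angle

end ToricCY

end

/-! ### The theorem -/

open ToricCY
theorem mainTheorem2 {m d n : ℕ} (Sg : SmoothFan m d)
    {M : Type*} [TopologicalSpace M] [T2Space M] [ChartedSpace (Cm m) M]
    [IsManifold 𝓘(ℂ, Cm m) ω M] [MulAction (CTorus m) M]
    (X : ToricManifold Sg M) (K : ToricKahler X)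
    (γ : Fin m → ℤ) (hγ : ∀ i, ∑ k, γ k * Sg.ray i k = 1)
    (ζ : Fin n → Lie m) (hζ : LinearIndependent ℝ ζ) (c : Fin n → ℝ)
    (hint : ∃ y ∈ interior (Set.range K.mu), ∀ i, pair y (ζ i) = c i)
    (hreg : ∀ y ∈ Set.range K.mu, (∀ i, pair y (ζ i) = c i) → K.IsRegularPt ζ y) :
    Nonempty (EmbeddedSubmanifold m (K.realLevel ζ c) (m - n)) ∧
    ∀ N : EmbeddedSubmanifold m (K.realLevel ζ c) (m - n),
      letI : ChartedSpace (EuclideanSpace ℝ (Fin (m - n))) (K.realLevel ζ c) := N.chartedSpace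
      (∀ r : ℝ, 0 < r →
        (∀ v ∈ ballZeta ζ r, (2 : ℝ) • (v : Lie m) ∈ intLattice m → v = 0) →
        IsLagrangianImmersion ((𝓡 (m - n)).prod 𝓘(ℝ, spanZeta ζ)) K.form (K.immBall ζ c r) ∧
        (IsSpecialLagrangian ((𝓡 (m - n)).prod 𝓘(ℝ, spanZeta ζ)) K.form (X.volumeForm γ)
            (K.immBall ζ c r) ↔
          ∀ i, pair (intVec γ) (ζ i) = 0)) ∧
      (SpecialCondition ζ →
        IsLagrangianImmersion ((𝓡 (m - n)).prod 𝓘(ℝ, spanZeta ζ)) K.form (K.immTorus ζ c) ∧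
        (IsSpecialLagrangian ((𝓡 (m - n)).prod 𝓘(ℝ, spanZeta ζ)) K.form (X.volumeForm γ)
            (K.immTorus ζ c) ↔
          ∀ i, pair (intVec γ) (ζ i) = 0)) := by
  -- Independence of the `ζ_i` makes the truncated difference `m - n` the true one.
  have hnm : n ≤ m := by simpa using hζ.fintype_card_le_finrank
  refine ⟨K.nonempty_embeddedSubmanifold hζ hreg, fun N => ?_⟩
  let _ : ChartedSpace (EuclideanSpace ℝ (Fin (m - n))) (K.realLevel ζ c) := N.chartedSpace
  have hk : m - n + n = m := Nat.sub_add_cancel hnm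
  have hne := K.realLevel_nonempty ζ c hint
  refine ⟨fun r hr _ => ?_, fun _ => ?_⟩
  · have : Nonempty (ballZeta ζ r) := ⟨⟨0, Metric.mem_ball_self hr⟩⟩
    exact K.isLagrangianImmersion_and_iff N.smooth_val N.injective_mfderiv hne hreg hζ hk hγ
      K.immBall_eventuallyEq
  · exact K.isLagrangianImmersion_and_iff N.smooth_val N.injective_mfderiv hne hreg hζ hk hγ
      K.immTorus_eventuallyEq
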